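/- **Model.** Let $n\ge 1$ and $f\ge 0$ be integers with $f<n/2$. Consider an asynchronous system of $n$ processes $p_1,\dots,p_n$ with identifiers $\Pi=\{1,\dots,n\}$ that exchange messages. Messages are neither created, altered nor duplicated by the network, may be delivered with arbitrary finite delays and in any order, and every message sent by a correct process to a correct process is eventually received. Handlers are executed atomically. A process may crash, after which it takes no more steps; a process is *faulty* in an execution if it crashes in it, and *correct* otherwise. At most $f$ processes are faulty in any execution. **Shared memory.** There is a set of registers with integer values, initially $0$. Processes invoke operations $\mathrm{READ}(r)$, which return a value, and $\mathrm{WRITE}(r,v)$, which return OK; a process may invoke an operation only if it has no outstanding one. The *history* of an execution is the (finite or infinite) sequence of its invocation and response events, in the order in which they occur; $H|p_i$ is the subsequence of the events of $H$ that occur in $p_i$. A history is *complete* if every invocation in it has a matching response. It is *sequential* if it alternates between invocations and responses, starting with an invocation (unless it is empty), each response matching the invocation immediately before it; it may end in an invocation. A sequential history is *legal* if each read that completes in it returns the value written by the last preceding write to the same register, or $0$ if there is none. A history $H$ is *sequentially consistent* if there is a legal sequential history $S$ with $S|p_i=H|p_i$ for every $i\in\Pi$. **Algorithm SC-ABD.**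 Timestamps are pairs (logical time, process identifier); timestamps, and timestamp-value pairs, are ordered lexicographically. Process $p_i$ has the variables $lt=0$ (logical time), $rid=0$ (request identifier), $tvps$ (a map from registers to timestamp-value pairs, initially constant $((0,0),0)$), $responses=\emptyset$, and $reading$, $rreg$, $rval$ (initially arbitrary). To broadcast is to send to all processes, including oneself. The handlers of $p_i$ are: * $\mathrm{READ}(r)$ is invoked: $lt\gets lt+1$; $reading\gets true$; $rreg\gets r$; $rid\gets rid+1$; broadcast $\langle\text{query},lt,rid,r\rangle$. * $\langle\text{query},lt',rid',r\rangle$ is received from $p_j$: $lt\gets\max(lt,lt')+1$; send $\langle\text{response},lt,rid',tvps[r]\rangle$ to $p_j$. * $\langle\text{response},lt',rid',tsv'\rangle$ is received from $p_j$ with $rid=rid'$: $lt\gets\max(lt,lt')+1$; $responses\gets responses\cup\{(tsv',j)\}$; if $|responses|=\lfloor n/2\rfloor+1$ then let $(tsv,\_)$ be the maximum of $responses$, set $rval$ to the value in $tsv$, $responses\gets\emptyset$, $rid\gets rid+1$, and broadcast $\langle\text{update},lt,rid,rreg,tsv\rangle$. * $\mathrm{WRITE}(r,v)$ is invoked: $lt\gets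 lt+1$; $reading\gets false$; $tsv\gets((lt,i),v)$; $rid\gets rid+1$; broadcast $\langle\text{update},lt,rid,r,tsv\rangle$. * $\langle\text{update},lt',rid',r,tsv'\rangle$ is received from $p_j$: $lt\gets\max(lt,lt')+1$; $tvps[r]\gets\max(tvps[r],tsv')$; send $\langle\text{ack},lt,rid'\rangle$ to $p_j$. * $\langle\text{ack},lt',rid'\rangle$ is received from $p_j$ with $rid=rid'$: $lt\gets\max(lt,lt')+1$; $responses\gets responses\cup\{j\}$; if $|responses|=\lfloor n/2\rfloor+1$ then $responses\gets\emptyset$, $rid\gets rid+1$, and the outstanding operation returns $rval$ if $reading$, and OK otherwise. Responses and acks with $rid\ne rid'$ are ignored. **Theorem.** Algorithm SC-ABD is a correct implementation of sequentially consistent distributed shared memory, that is, in this model: 1. (Termination) in every execution, every operation invoked by a correct process eventually completes; 2. (Sequential consistency) for every execution, if its history is complete, then its history is sequentially consistent. This holds for finite and infinite executions, and does not need the assumption that messages are eventually received. -/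

import Mathlib

namespace SCABD

/-! ### Operations, events, and histories -/

/-- Operations on integer-valued registers with identifiers in `X`. -/
inductive Op (X : Type*) where
  | read (r : X)
  | write (r : X) (v : ℤ)

/-- Results of operations: a read returns a value, a write returns `OK`. -/
inductive Ret where
  | value (v : ℤ)
  | ok

/-- The result `a` is of the kind that the operation returns. -/
def Op.Accepts {X : Type*} : Op X → Ret → Prop
  | .read _, .value _ => True
  | .write _ _, .ok => True
  | _, _ => False

/-- Invocation and response events, with the process where they occur. As a process has at most
one outstanding operation, the operation to which a response belongs is the last one that the
process invoked. -/
inductive Event (X : Type*) (n : ℕ) where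
  | inv (p : Fin n) (o : Op X)
  | res (p : Fin n) (a : Ret)

/-- The process where an event occurs. -/
def Event.proc {X : Type*} {n : ℕ} : Event X n → Fin n
  | .inv p _ => p
  | .res p _ => p

/-- The `k`-th entry (from `0`) among the entries `some a` of `s`, or `none` if there are at most
`k` of them. -/
noncomputable def nthEntry {α : Type*} (s : ℕ → Option α) (k : ℕ) : Option α :=
  open Classical in
  if ∀ h : {t | (s t).isSome = true}.Finite, k < h.toFinset.card then
    s (Nat.nth (fun t => (s t).isSome = true) k)
  else none

theorem nthEntry_isSeq {α : Type*} (s : ℕ → Option α) : Stream'.IsSeq (nthEntry s) := by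
  intro k hk
  have hk' : nthEntry s k = none := hk
  change nthEntry s (k + 1) = none
  unfold nthEntry at hk' ⊢
  split_ifs at hk' with h
  · have := Nat.nth_mem (p := fun t => (s t).isSome = true) k h
    simp [hk'] at this
  · rw [if_neg]
    intro h'
    exact h fun hf => lt_trans (Nat.lt_succ_self k) (h' hf)

/-- The finite or infinite sequence of the `a` with `some a` an entry of `s`, in the same order. -/
noncomputable def compact {α : Type*} (s : ℕ → Option α) : Stream'.Seq α :=
  ⟨nthEntry s, nthEntry_isSeq s⟩

/-- A history: a finite or infinite sequence of events. -/
abbrev History (X : Type*) (n : ℕ) := Stream'.Seq (Event X n)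

namespace History

variable {X : Type*} {n : ℕ}

/-- The process subhistory: the subsequence of the events that occur in process `p`. -/
noncomputable def proj (H : History X n) (p : Fin n) : History X n :=
  compact fun k => (H.get? k).filter fun e => decide (e.proc = p)

/-- Equivalent histories have the same process subhistories. -/
def Equivalent (H H' : History X n) : Prop :=
  ∀ p, H.proj p = H'.proj p

/-- The history is an alternating sequence of invocations and matching responses, starting with an
invocation (if it is not empty); it may end in an invocation. -/
def Sequential (H : History X n) : Prop :=
  (∀ k e, H.get? (2 * k) = some e → ∃ p o, e = Event.inv p o) ∧
  (∀ k e, H.get? (2 * k + 1) = some e →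
    ∃ p o a, H.get? (2 * k) = some (Event.inv p o) ∧ e = Event.res p a ∧ o.Accepts a)

/-- The value written by the last write to `r` invoked among the first `k` events, and `0` if there
is no such write. -/
noncomputable def regValue (H : History X n) (r : X) : ℕ → ℤ
  | 0 => 0
  | k + 1 =>
    match H.get? k with
    | some (Event.inv _ (Op.write r' v)) =>
      open Classical in if r' = r then v else regValue H r k
    | _ => regValue H r k

/-- The sequential specification of read/write registers that are initially zero. -/
def Legal (S : History X n) : Prop :=
  S.Sequential ∧
  ∀ k p q r v, S.get? k = some (Event.inv p (Op.read r)) →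
    S.get? (k + 1) = some (Event.res q (Ret.value v)) → v = regValue S r k

/-- Sequential consistency. -/
def SC (H : History X n) : Prop :=
  ∃ S : History X n, S.Legal ∧ S.Equivalent H

/-- The operation invoked at position `k` of the history completes: a matching response occurs at a
later position `l`, and it is the next event of the invoking process. -/
def CompletesAt (H : History X n) (k : ℕ) : Prop :=
  ∃ p o l a, k < l ∧ H.get? k = some (Event.inv p o) ∧ H.get? l = some (Event.res p a) ∧
    o.Accepts a ∧ ∀ m e, k < m → m < l → H.get? m = some e → e.proc ≠ p

/-- No operation is pending. -/
def Complete (H : History X n) : Prop :=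
  ∀ k p o, H.get? k = some (Event.inv p o) → H.CompletesAt k

end History

/-! ### The algorithm -/

/-- Timestamps (logical time, process identifier), ordered lexicographically. -/
abbrev Timestamp := ℕ ×ₗ ℕ

/-- Timestamp-value pairs. -/
abbrev TSV := Timestamp ×ₗ ℤ

/-- The process with index `i : Fin n` has the identifier `i + 1` in `{1, …, n}`. -/
def pid {n : ℕ} (i : Fin n) : ℕ := (i : ℕ) + 1

/-- Messages. -/
inductive Msg (X : Type*) where
  | query (lt rid : ℕ) (r : X)
  | response (lt rid : ℕ) (tsv : TSV)
  | update (lt rid : ℕ) (r : X) (tsv : TSV)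
  | ack (lt rid : ℕ)

/-- A message with its sender and its addressee. -/
structure Packet (X : Type*) (n : ℕ) where
  src : Fin n
  dst : Fin n
  msg : Msg X

/-- The local variables of a process. The set of responses is kept as two sets, by type: the
answers to a query with their senders, and the senders of acknowledgements. -/
structure ProcState (X : Type*) (n : ℕ) where
  lt : ℕ
  rid : ℕ
  tvps : X → TSV
  responses : Finset (TSV ×ₗ Fin n)
  acks : Finset (Fin n)
  reading : Bool
  rreg : X
  rval : ℤ

/-- Initial local states; `reading`, `rreg` and `rval` are not constrained. -/
def ProcState.Initial {X : Type*} {n : ℕ} (s : ProcState X n) : Prop :=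
  s.lt = 0 ∧ s.rid = 0 ∧ (∀ r, s.tvps r = toLex (toLex (0, 0), 0)) ∧
    s.responses = ∅ ∧ s.acks = ∅

/-- The effect of the execution of a handler: the new local state, the messages sent, and the
result returned to the caller, if any. -/
structure Effect (X : Type*) (n : ℕ) where
  state : ProcState X n
  sends : Multiset (Packet X n)
  ret : Option Ret

section Handlers

variable {X : Type*} {n : ℕ}

/-- Send `m` to all processes, including the sender `i`. -/
def bcast (i : Fin n) (m : Msg X) : Multiset (Packet X n) :=
  (Finset.univ : Finset (Fin n)).val.map fun j => ⟨i, j, m⟩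

/-- The size of a majority, `⌊n / 2⌋ + 1`. -/
def quorum (n : ℕ) : ℕ := n / 2 + 1

/-- Process `i` in local state `s` executes the handler of an invocation. -/
def onInvoke (i : Fin n) (s : ProcState X n) : Op X → Effect X n
  | .read r =>
    let lt := s.lt + 1
    let rid := s.rid + 1
    { state := { s with lt := lt, reading := true, rreg := r, rid := rid }
      sends := bcast i (.query lt rid r)
      ret := none }
  | .write r v =>
    let lt := s.lt + 1
    let rid := s.rid + 1
    { state := { s with lt := lt, reading := false, rid := rid }
      sends := bcast i (.update lt rid r (toLex (toLex (lt, pid i), v)))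
      ret := none }

/-- Process `i` in local state `s` receives a message from process `j`. Responses and acks with a
request identifier other than the current one have no effect. -/
noncomputable def onReceive (i : Fin n) (s : ProcState X n) (j : Fin n) : Msg X → Effect X n
  | .query lt' rid' r =>
    let lt := max s.lt lt' + 1
    { state := { s with lt := lt }
      sends := {⟨i, j, .response lt rid' (s.tvps r)⟩}
      ret := none }
  | .response lt' rid' tsv' =>
    if s.rid = rid' then
      let lt := max s.lt lt' + 1
      let responses := insert (toLex (tsv', j)) s.responses
      if responses.card = quorum n then
        let tsv : TSV := (ofLex (responses.max' (Finset.insert_nonempty _ _))).1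
        let rid := s.rid + 1
        { state := { s with lt := lt, rval := (ofLex tsv).2, responses := ∅, rid := rid }
          sends := bcast i (.update lt rid s.rreg tsv)
          ret := none }
      else
        { state := { s with lt := lt, responses := responses }, sends := 0, ret := none }
    else { state := s, sends := 0, ret := none }
  | .update lt' rid' r tsv' =>
    let lt := max s.lt lt' + 1
    { state := { s with
        lt := lt
        tvps := open Classical in Function.update s.tvps r (max (s.tvps r) tsv') }
      sends := {⟨i, j, .ack lt rid'⟩}
      ret := none }
  | .ack lt' rid' =>
    if s.rid = rid' then
      let lt := max s.lt lt' + 1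
      let acks := insert j s.acks
      if acks.card = quorum n then
        { state := { s with lt := lt, acks := ∅, rid := s.rid + 1 }
          sends := 0
          ret := some (if s.reading then Ret.value s.rval else Ret.ok) }
      else
        { state := { s with lt := lt, acks := acks }, sends := 0, ret := none }
    else { state := s, sends := 0, ret := none }

end Handlers

/-! ### Executions -/

/-- A global state of the system. -/
structure Config (X : Type*) (n : ℕ) where
  /-- the local states of the processes -/
  procs : Fin n → ProcState X n
  /-- the messages that have been sent and not yet received -/
  transit : Multiset (Packet X n)
  /-- the processes that have an outstanding operation -/
  busy : Finset (Fin n)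
  /-- the processes that have crashed -/
  crashed : Finset (Fin n)

/-- Initial global states. -/
def Config.Initial {X : Type*} {n : ℕ} (c : Config X n) : Prop :=
  (∀ i, (c.procs i).Initial) ∧ c.transit = 0 ∧ c.busy = ∅ ∧ c.crashed = ∅

/-- What may happen in a step of the system. -/
inductive Step (X : Type*) (n : ℕ) where
  | idle
  | crash (i : Fin n)
  | invoke (i : Fin n) (o : Op X)
  | receive (m : Packet X n)

/-- `Trans c s ev c'`: the step `s` leads from the global state `c` to `c'`, and `ev` is the
invocation or response event that occurs in it, if any. Any message in transit to a process that
has not crashed can be received, in any order; a message is received at most once. -/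
inductive Trans {X : Type*} {n : ℕ} :
    Config X n → Step X n → Option (Event X n) → Config X n → Prop where
  | idle (c : Config X n) : Trans c .idle none c
  | crash (c : Config X n) (i : Fin n) (hi : i ∉ c.crashed) :
      Trans c (.crash i) none { c with crashed := insert i c.crashed }
  | invoke (c : Config X n) (i : Fin n) (o : Op X) (hi : i ∉ c.crashed) (hb : i ∉ c.busy) :
      Trans c (.invoke i o) (some (.inv i o))
        { c with
          procs := Function.update c.procs i (onInvoke i (c.procs i) o).state
          transit := c.transit + (onInvoke i (c.procs i) o).sends
          busy := insert i c.busy }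
  | receive (c : Config X n) (m : Packet X n) (rest : Multiset (Packet X n))
      (hm : c.transit = m ::ₘ rest) (hi : m.dst ∉ c.crashed) :
      Trans c (.receive m)
        ((onReceive m.dst (c.procs m.dst) m.src m.msg).ret.map (Event.res m.dst))
        { c with
          procs := Function.update c.procs m.dst
            (onReceive m.dst (c.procs m.dst) m.src m.msg).state
          transit := rest + (onReceive m.dst (c.procs m.dst) m.src m.msg).sends
          busy := if (onReceive m.dst (c.procs m.dst) m.src m.msg).ret.isSome
            then c.busy.erase m.dst else c.busy }

/-- An execution of the algorithm by `n` processes. Idle steps are allowed, so that finite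
executions are included (as those that are idle from some time on). -/
structure Execution (X : Type*) (n : ℕ) where
  config : ℕ → Config X n
  step : ℕ → Step X n
  event : ℕ → Option (Event X n)
  initial : (config 0).Initial
  trans : ∀ t, Trans (config t) (step t) (event t) (config (t + 1))

namespace Execution

variable {X : Type*} {n : ℕ}

/-- The faulty processes: those that crash. All others are correct. -/
def faulty (E : Execution X n) : Set (Fin n) :=
  {i | ∃ t, i ∈ (E.config t).crashed}

/-- Every message sent by a correct process to a correct process is eventually received. -/
def EventualDelivery (E : Execution X n) : Prop :=
  ∀ t m, m ∈ (E.config t).transit → m.src ∉ E.faulty → m.dst ∉ E.faulty →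
    ∃ t', t ≤ t' ∧ E.step t' = .receive m

/-- The history of an execution: the sequence of its invocation and response events. -/
noncomputable def history (E : Execution X n) : History X n :=
  compact E.event

/-- Every operation invoked by a correct process completes. -/
def Terminates (E : Execution X n) : Prop :=
  ∀ k i o, E.history.get? k = some (Event.inv i o) → i ∉ E.faulty → E.history.CompletesAt k

end Execution

end SCABD

/-!
A completed operation has stored its timestamp-value pair, its *tag*, at a quorum of processes by
the time their clocks reach its end clock, and a read takes its tag from a quorum of processes whose
clocks have passed its start clock. As two quorums intersect, an operation whose start clock is
greater than the end clock of another one on the same register has a larger or equal tag, and a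
strictly larger one if it is a write. Hence, on each register, ordering the operations by tag, the
write of a tag before its reads and the reads of a tag by start clock, is legal and respects logical
time. To merge these orders, each operation is placed at the latest start clock among the operations
up to it on its register. This is at least its start clock and at most its end clock, and the end
clock of an operation is less than the start clock of the next operation of the same process. So the
merged order is consistent with the order of every process.

For termination, at any time there is, for each process from which the current request of a client
is still unanswered, exactly one packet in transit that belongs to this request and this process. An
operation uses at most two request identifiers, so if it does not complete, the identifier is
eventually constant, and the client then hears from every correct process, hence from a quorum: a
contradiction, because it moves on as soon as it has heard from a quorum.
-/

namespace SCABD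

/-! ### Sequences with gaps -/

section Sequences

variable {α : Type*} {s s' : ℕ → Option α} {t u : ℕ} {a : α}

/-- The position in `compact s` of an entry `s t = some a`, namely the number of entries of this
form before `t`. -/
noncomputable def compactIndex (s : ℕ → Option α) (t : ℕ) : ℕ :=
  Nat.count (fun u => (s u).isSome = true) t

theorem compactIndex_lt_compactIndex (ht : s t = some a) (h : t < u) :
    compactIndex s t < compactIndex s u :=
  Nat.count_strict_mono (by simp [ht]) h

theorem lt_of_compactIndex_lt (h : compactIndex s t < compactIndex s u) : t < u :=
  Nat.lt_of_count_lt_count h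

theorem nth_compactIndex (ht : s t = some a) :
    Nat.nth (fun u => (s u).isSome = true) (compactIndex s t) = t :=
  Nat.nth_count (p := fun u => (s u).isSome = true) (by simp [ht])

theorem compactIndex_lt_card (ht : s t = some a) (hf : {u | (s u).isSome = true}.Finite) :
    compactIndex s t < hf.toFinset.card :=
  Nat.count_lt_card (p := fun u => (s u).isSome = true) hf (by simp [ht])

theorem compact_get?_eq_some {k : ℕ} :
    (compact s).get? k = some a ↔ ∃ t, s t = some a ∧ compactIndex s t = k := by
  change nthEntry s k = some a ↔ _
  unfold nthEntry
  constructor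
  · intro h
    split_ifs at h with hk
    exact ⟨_, h, Nat.count_nth hk⟩
  · rintro ⟨t, ht, rfl⟩
    rw [if_pos fun hf => compactIndex_lt_card ht hf, nth_compactIndex ht, ht]

theorem compact_get?_compactIndex (ht : s t = some a) :
    (compact s).get? (compactIndex s t) = some a :=
  compact_get?_eq_some.2 ⟨t, ht, rfl⟩

/-- `φ` is an order isomorphism from the positions of the entries `some a` of `s'` to those of `s`,
and the entries at corresponding positions agree. -/
structure EntryIso (s' s : ℕ → Option α) (φ : ℕ → ℕ) : Prop where
  map_eq_some : ∀ m a, s' m = some a → s (φ m) = some a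
  lt : ∀ m m' a a', s' m = some a → s' m' = some a' → m < m' → φ m < φ m'
  surj : ∀ t a, s t = some a → ∃ m, s' m = some a ∧ φ m = t

theorem EntryIso.compactIndex_eq {φ : ℕ → ℕ} (h : EntryIso s' s φ) {m : ℕ} (hm : s' m = some a) :
    compactIndex s (φ m) = compactIndex s' m := by
  simp only [compactIndex, Nat.count_eq_card_filter_range]
  symm
  refine Finset.card_nbij φ ?_ ?_ ?_
  · intro x hx
    simp only [Finset.coe_filter, Finset.mem_range, Option.isSome_iff_exists,
      Set.mem_ofPred_eq] at hx ⊢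
    obtain ⟨hxm, b, hb⟩ := hx
    exact ⟨h.lt _ _ _ _ hb hm hxm, b, h.map_eq_some _ _ hb⟩
  · refine StrictMonoOn.injOn fun x hx y hy hxy => ?_
    simp only [Finset.coe_filter, Option.isSome_iff_exists, Set.mem_ofPred_eq] at hx hy
    obtain ⟨⟨-, b, hb⟩, -, c, hc⟩ := And.intro hx hy
    exact h.lt _ _ _ _ hb hc hxy
  · intro y hy
    simp only [Finset.coe_filter, Finset.mem_range, Option.isSome_iff_exists,
      Set.mem_ofPred_eq] at hy
    obtain ⟨hym, b, hb⟩ := hy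
    obtain ⟨x, hx, rfl⟩ := h.surj _ _ hb
    refine ⟨x, ?_, rfl⟩
    simp only [Finset.coe_filter, Finset.mem_range, Set.mem_ofPred_eq]
    refine ⟨?_, by simp [hx]⟩
    rcases lt_trichotomy x m with hlt | rfl | hlt
    · exact hlt
    · exact absurd hym (lt_irrefl _)
    · exact absurd (h.lt _ _ _ _ hm hx hlt) hym.not_gt

theorem EntryIso.compact_eq {φ : ℕ → ℕ} (h : EntryIso s' s φ) : compact s' = compact s := by
  refine Stream'.Seq.ext fun k => Option.ext fun a => ?_
  rw [compact_get?_eq_some, compact_get?_eq_some]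
  constructor
  · rintro ⟨m, hm, rfl⟩
    exact ⟨φ m, h.map_eq_some _ _ hm, h.compactIndex_eq hm⟩
  · rintro ⟨t, ht, rfl⟩
    obtain ⟨m, hm, rfl⟩ := h.surj _ _ ht
    exact ⟨m, hm, (h.compactIndex_eq hm).symm⟩

theorem compact_filter_compact (s : ℕ → Option α) (q : α → Bool) :
    compact (fun k => ((compact s).get? k).filter q) = compact fun t => (s t).filter q := by
  refine EntryIso.compact_eq (φ := Nat.nth fun u => (s u).isSome = true) ⟨?_, ?_, ?_⟩
  · simp only [Option.filter_eq_some_iff, compact_get?_eq_some]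
    rintro _ a ⟨⟨t, ht, rfl⟩, ha⟩
    rw [nth_compactIndex ht]
    exact ⟨ht, ha⟩
  · simp only [Option.filter_eq_some_iff, compact_get?_eq_some]
    rintro _ _ a b ⟨⟨t, ht, rfl⟩, -⟩ ⟨⟨u, hu, rfl⟩, -⟩ hlt
    rw [nth_compactIndex ht, nth_compactIndex hu]
    exact lt_of_compactIndex_lt hlt
  · simp only [Option.filter_eq_some_iff]
    rintro t a ⟨ht, ha⟩
    exact ⟨compactIndex s t, ⟨compact_get?_compactIndex ht, ha⟩, nth_compactIndex ht⟩

end Sequences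

section Completion

variable {X : Type*} {n : ℕ} {s : ℕ → Option (Event X n)} {t u v : ℕ} {p : Fin n} {o o' : Op X}
  {a : Ret}

/-- In the sequence of events `s`, the operation `o` invoked by `p` at time `t` returns `a` at
time `u`, and this is the next event of `p`. -/
structure CompletesBetween (s : ℕ → Option (Event X n)) (t u : ℕ) (p : Fin n) (o : Op X)
    (a : Ret) : Prop where
  lt : t < u
  inv : s t = some (.inv p o)
  res : s u = some (.res p a)
  accepts : o.Accepts a
  proc_ne : ∀ v e, t < v → v < u → s v = some e → e.proc ≠ p

theorem CompletesBetween.res_lt_inv (h : CompletesBetween s t u p o a)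
    (hv : s v = some (.inv p o')) (htv : t < v) : u < v := by
  rcases lt_trichotomy u v with huv | rfl | hvu
  · exact huv
  · cases h.res.symm.trans hv
  · exact absurd rfl (h.proc_ne v _ htv hvu hv)

theorem completesAt_compactIndex_iff (ht : s t = some (.inv p o)) :
    History.CompletesAt (compact s) (compactIndex s t) ↔
      ∃ u a, CompletesBetween s t u p o a := by
  have hget := compact_get?_compactIndex ht
  constructor
  · rintro ⟨p', o', l, a, hl, hinv, hres, hacc, hne⟩
    cases hget.symm.trans hinv
    obtain ⟨u, hu, rfl⟩ := compact_get?_eq_some.1 hres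
    exact ⟨u, a, lt_of_compactIndex_lt hl, ht, hu, hacc, fun v e htv hvu hv =>
      hne _ e (compactIndex_lt_compactIndex ht htv) (compactIndex_lt_compactIndex hv hvu)
        (compact_get?_compactIndex hv)⟩
  · rintro ⟨u, a, h⟩
    refine ⟨p, o, compactIndex s u, a, compactIndex_lt_compactIndex ht h.lt, hget,
      compact_get?_compactIndex h.res, h.accepts, fun m e htm hmu hm => ?_⟩
    obtain ⟨v, hv, rfl⟩ := compact_get?_eq_some.1 hm
    exact h.proc_ne v e (lt_of_compactIndex_lt htm) (lt_of_compactIndex_lt hmu) hv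

end Completion

section Rank

variable {O : Type*} [LinearOrder O] [LocallyFiniteOrderBot O] {x y : O}

/-- The position of `x` in the increasing enumeration of `O`. -/
def rank (x : O) : ℕ := (Finset.Iio x).card

theorem rank_strictMono : StrictMono (rank : O → ℕ) := fun _ _ h =>
  Finset.card_lt_card (Finset.Iio_ssubset_Iio h)

theorem rank_injective : Function.Injective (rank : O → ℕ) := rank_strictMono.injective

theorem rank_lt_rank : rank x < rank y ↔ x < y := rank_strictMono.lt_iff_lt

theorem exists_rank_eq {k : ℕ} (hk : k < rank x) : ∃ y : O, rank y = k := by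
  have hsub : (Finset.Iio x).image rank ⊆ Finset.range (rank x) := by
    intro m hm
    obtain ⟨y, hy, rfl⟩ := Finset.mem_image.1 hm
    exact Finset.mem_range.2 (rank_strictMono (Finset.mem_Iio.1 hy))
  have hcard : (Finset.range (rank x)).card ≤ ((Finset.Iio x).image rank).card := by
    rw [Finset.card_image_of_injective _ rank_injective, Finset.card_range, rank]
  have hmem : k ∈ (Finset.Iio x).image rank :=
    Finset.eq_of_subset_of_card_le hsub hcard ▸ Finset.mem_range.2 hk
  obtain ⟨y, -, hy⟩ := Finset.mem_image.1 hmem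
  exact ⟨y, hy⟩

variable {β : Type*} {f g : O → β} {m : ℕ} {b : β}

open Classical in
/-- The sequence `f x₀, g x₀, f x₁, g x₁, …` for the increasing enumeration `x₀, x₁, …` of `O`. -/
noncomputable def interleave (f g : O → β) (m : ℕ) : Option β :=
  if h : ∃ x : O, rank x = m / 2 then some (if m % 2 = 0 then f h.choose else g h.choose) else none

theorem interleave_two_mul_rank (f g : O → β) (x : O) :
    interleave f g (2 * rank x) = some (f x) := by
  have h : ∃ y : O, rank y = 2 * rank x / 2 := ⟨x, by omega⟩
  have hx : h.choose = x := rank_injective (h.choose_spec.trans (by omega))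
  rw [interleave, dif_pos h, hx, if_pos (by omega)]

theorem interleave_two_mul_rank_add_one (f g : O → β) (x : O) :
    interleave f g (2 * rank x + 1) = some (g x) := by
  have h : ∃ y : O, rank y = (2 * rank x + 1) / 2 := ⟨x, by omega⟩
  have hx : h.choose = x := rank_injective (h.choose_spec.trans (by omega))
  rw [interleave, dif_pos h, hx, if_neg (by omega)]

theorem interleave_eq_some (h : interleave f g m = some b) :
    ∃ x : O, (m = 2 * rank x ∧ f x = b) ∨ (m = 2 * rank x + 1 ∧ g x = b) := by
  unfold interleave at h
  split_ifs at h with hm heven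
  · exact ⟨hm.choose, .inl ⟨by have := hm.choose_spec; omega, Option.some.inj h⟩⟩
  · exact ⟨hm.choose, .inr ⟨by have := hm.choose_spec; omega, Option.some.inj h⟩⟩

theorem interleave_isSeq (f g : O → β) : Stream'.IsSeq (interleave f g) := by
  intro m (hm : interleave f g m = none)
  by_contra h
  obtain ⟨b, hb⟩ := Option.ne_none_iff_exists'.1 h
  obtain ⟨x, ⟨hx, -⟩ | ⟨hx, -⟩⟩ := interleave_eq_some hb
  · obtain ⟨y, hy⟩ := exists_rank_eq (x := x) (k := rank x - 1) (by omega)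
    have hsome := interleave_two_mul_rank_add_one f g y
    rw [hy, show 2 * (rank x - 1) + 1 = m by omega, hm] at hsome
    cases hsome
  · have hsome := interleave_two_mul_rank f g x
    rw [show 2 * rank x = m by omega, hm] at hsome
    cases hsome

end Rank

/-! ### Sequential histories from ordered operations -/

section Criterion

variable {X : Type*} {n : ℕ}

section RegValue

variable {H : History X n} {r : X} {j k : ℕ}

theorem regValue_succ_of_not_write (h : ∀ p v, H.get? k ≠ some (.inv p (.write r v))) :
    H.regValue r (k + 1) = H.regValue r k := by
  rw [History.regValue]
  split
  · next h' =>
    rw [if_neg]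
    rintro rfl
    exact h _ _ h'
  · rfl

theorem regValue_eq_zero (h : ∀ m p v, m < k → H.get? m ≠ some (.inv p (.write r v))) :
    H.regValue r k = 0 := by
  induction k with
  | zero => rfl
  | succ k ih =>
    rw [regValue_succ_of_not_write fun p v => h k p v k.lt_succ_self]
    exact ih fun m p v hm => h m p v (hm.trans k.lt_succ_self)

theorem regValue_eq_of_write {q : Fin n} {w : ℤ} (hj : j < k)
    (hw : H.get? j = some (.inv q (.write r w)))
    (h : ∀ m p v, j < m → m < k → H.get? m ≠ some (.inv p (.write r v))) :
    H.regValue r k = w := by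
  induction k with
  | zero => omega
  | succ k ih =>
    rcases (Nat.lt_succ_iff.1 hj).eq_or_lt with rfl | hlt
    · rw [History.regValue, hw]
      simp
    · rw [regValue_succ_of_not_write fun p v => h k p v hlt k.lt_succ_self]
      exact ih hlt fun m p v hm hm' => h m p v hm (hm'.trans k.lt_succ_self)

end RegValue

/-- The completed operations of the sequence of events `s`, indexed by `O`: every entry of `s` is
the invocation or the response of an operation of the family. -/
structure OperationFamily (s : ℕ → Option (Event X n)) (O : Type*) where
  proc : O → Fin n
  op : O → Op X
  ret : O → Ret
  invTime : O → ℕ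
  resTime : O → ℕ
  completes : ∀ x, CompletesBetween s (invTime x) (resTime x) (proc x) (op x) (ret x)
  exhaustive : ∀ t e, s t = some e → ∃ x, t = invTime x ∨ t = resTime x
  injective : Function.Injective invTime

namespace OperationFamily

variable {s : ℕ → Option (Event X n)} {O : Type*} (F : OperationFamily s O)

/-- Reads return the last value that is written to the register before them in the order of `O`,
and `0` if there is none. -/
def ReadsLastWritten [LT O] : Prop :=
  ∀ x r v, F.op x = .read r → F.ret x = .value v →
    (v = 0 ∧ ∀ y w, F.op y = .write r w → ¬ y < x) ∨
    ∃ y, F.op y = .write r v ∧ y < x ∧ ∀ z w, F.op z = .write r w → y < z → ¬ z < x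

variable [LinearOrder O] [LocallyFiniteOrderBot O] {k m : ℕ}

/-- The operations of the family, executed one after the other in the order of `O`. -/
noncomputable def sequentialHistory : History X n :=
  ⟨interleave (fun x => .inv (F.proc x) (F.op x)) (fun x => .res (F.proc x) (F.ret x)),
    interleave_isSeq _ _⟩

theorem sequentialHistory_two_mul_rank (x : O) :
    F.sequentialHistory.get? (2 * rank x) = some (.inv (F.proc x) (F.op x)) :=
  interleave_two_mul_rank (fun x => Event.inv (F.proc x) (F.op x))
    (fun x => .res (F.proc x) (F.ret x)) x

theorem sequentialHistory_two_mul_rank_add_one (x : O) :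
    F.sequentialHistory.get? (2 * rank x + 1) = some (.res (F.proc x) (F.ret x)) :=
  interleave_two_mul_rank_add_one (fun x => Event.inv (F.proc x) (F.op x))
    (fun x => .res (F.proc x) (F.ret x)) x

variable {F}

theorem sequentialHistory_eq_some {e : Event X n} (h : F.sequentialHistory.get? m = some e) :
    ∃ x, (m = 2 * rank x ∧ .inv (F.proc x) (F.op x) = e) ∨
      (m = 2 * rank x + 1 ∧ .res (F.proc x) (F.ret x) = e) :=
  interleave_eq_some h

theorem sequentialHistory_eq_inv {p : Fin n} {o : Op X}
    (h : F.sequentialHistory.get? m = some (.inv p o)) :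
    ∃ x, m = 2 * rank x ∧ F.proc x = p ∧ F.op x = o := by
  obtain ⟨x, ⟨hm, hx⟩ | ⟨-, hx⟩⟩ := sequentialHistory_eq_some h
  · cases hx
    exact ⟨x, hm, rfl, rfl⟩
  · cases hx

variable (F) in
theorem sequentialHistory_sequential : F.sequentialHistory.Sequential := by
  constructor
  · intro k e h
    obtain ⟨x, ⟨-, rfl⟩ | ⟨hk, -⟩⟩ := sequentialHistory_eq_some h
    · exact ⟨_, _, rfl⟩
    · omega
  · intro k e h
    obtain ⟨x, ⟨hk, -⟩ | ⟨hk, rfl⟩⟩ := sequentialHistory_eq_some h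
    · omega
    · obtain rfl : k = rank x := by omega
      exact ⟨F.proc x, F.op x, F.ret x, F.sequentialHistory_two_mul_rank x, rfl,
        (F.completes x).accepts⟩

theorem ReadsLastWritten.legal_sequentialHistory (h : F.ReadsLastWritten) :
    F.sequentialHistory.Legal := by
  refine ⟨F.sequentialHistory_sequential, fun k p q r v hinv hres => ?_⟩
  obtain ⟨x, rfl, -, hop⟩ := sequentialHistory_eq_inv hinv
  have hret : F.ret x = .value v := by
    rw [sequentialHistory_two_mul_rank_add_one, Option.some.injEq, Event.res.injEq] at hres
    exact hres.2
  symm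
  rcases h x r v hop hret with ⟨rfl, hnone⟩ | ⟨y, hy, hyx, hnone⟩
  · refine regValue_eq_zero fun m p v hm hw => ?_
    obtain ⟨y, rfl, -, hy⟩ := sequentialHistory_eq_inv hw
    exact hnone y v hy (rank_lt_rank.1 (by omega))
  · have hrank := rank_lt_rank.2 hyx
    refine regValue_eq_of_write (q := F.proc y) (j := 2 * rank y) (by omega)
      (by rw [sequentialHistory_two_mul_rank, hy]) fun m p w hm hm' hw => ?_
    obtain ⟨z, rfl, -, hz⟩ := sequentialHistory_eq_inv hw
    exact hnone z w hz (rank_lt_rank.1 (by omega)) (rank_lt_rank.1 (by omega))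

variable (F) in
/-- The time of the `m`-th event of `sequentialHistory` in the original sequence (and the junk value
`0` if there is no such event). -/
noncomputable def eventTime (m : ℕ) : ℕ := (interleave F.invTime F.resTime m).getD 0

variable (F) in
theorem eventTime_two_mul_rank (x : O) : F.eventTime (2 * rank x) = F.invTime x := by
  rw [eventTime, interleave_two_mul_rank, Option.getD_some]

variable (F) in
theorem eventTime_two_mul_rank_add_one (x : O) : F.eventTime (2 * rank x + 1) = F.resTime x := by
  rw [eventTime, interleave_two_mul_rank_add_one, Option.getD_some]

theorem apply_eventTime {e : Event X n} (h : F.sequentialHistory.get? m = some e) :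
    s (F.eventTime m) = some e := by
  obtain ⟨x, ⟨rfl, rfl⟩ | ⟨rfl, rfl⟩⟩ := sequentialHistory_eq_some h
  · rw [eventTime_two_mul_rank, (F.completes x).inv]
  · rw [eventTime_two_mul_rank_add_one, (F.completes x).res]

theorem exists_eventTime_eq {t : ℕ} {e : Event X n} (h : s t = some e) :
    ∃ m, F.sequentialHistory.get? m = some e ∧ F.eventTime m = t := by
  obtain ⟨x, rfl | rfl⟩ := F.exhaustive t e h
  · exact ⟨2 * rank x, by rw [sequentialHistory_two_mul_rank, ← h, (F.completes x).inv],
      F.eventTime_two_mul_rank x⟩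
  · exact ⟨2 * rank x + 1, by
      rw [sequentialHistory_two_mul_rank_add_one, ← h, (F.completes x).res],
      F.eventTime_two_mul_rank_add_one x⟩

theorem eventTime_lt_eventTime
    (hF : ∀ x y, F.proc x = F.proc y → F.invTime x < F.invTime y → x < y)
    {e e' : Event X n} (hk : F.sequentialHistory.get? k = some e)
    (hm : F.sequentialHistory.get? m = some e') (hproc : e.proc = e'.proc) (hkm : k < m) :
    F.eventTime k < F.eventTime m := by
  obtain ⟨x, hx⟩ := sequentialHistory_eq_some hk
  obtain ⟨y, hy⟩ := sequentialHistory_eq_some hm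
  have hxy : F.proc x = F.proc y := by
    rcases hx with ⟨-, rfl⟩ | ⟨-, rfl⟩ <;> rcases hy with ⟨-, rfl⟩ | ⟨-, rfl⟩ <;> exact hproc
  rcases lt_trichotomy x y with hlt | rfl | hlt
  · have hinv : F.invTime x < F.invTime y :=
      (lt_trichotomy _ _).resolve_right fun h => h.elim
        (fun h => hlt.ne (F.injective h)) fun h => hlt.not_gt (hF y x hxy.symm h)
    have hres : F.resTime x < F.invTime y :=
      (F.completes x).res_lt_inv (hxy ▸ (F.completes y).inv) hinv
    have hy' := (F.completes y).lt
    rcases hx with ⟨rfl, -⟩ | ⟨rfl, -⟩ <;> rcases hy with ⟨rfl, -⟩ | ⟨rfl, -⟩ <;>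
      simp only [eventTime_two_mul_rank, eventTime_two_mul_rank_add_one] <;> omega
  · obtain rfl : k = 2 * rank x := by omega
    obtain rfl : m = 2 * rank x + 1 := by omega
    rw [eventTime_two_mul_rank, eventTime_two_mul_rank_add_one]
    exact (F.completes x).lt
  · have := rank_lt_rank.2 hlt
    omega

theorem sequentialHistory_equivalent
    (hF : ∀ x y, F.proc x = F.proc y → F.invTime x < F.invTime y → x < y) :
    F.sequentialHistory.Equivalent (compact s) := by
  intro p
  rw [History.proj, History.proj, compact_filter_compact]
  refine EntryIso.compact_eq (φ := F.eventTime) ⟨?_, ?_, ?_⟩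
  · simp only [Option.filter_eq_some_iff]
    exact fun m e h => ⟨apply_eventTime h.1, h.2⟩
  · simp only [Option.filter_eq_some_iff, decide_eq_true_eq]
    exact fun m m' e e' h h' hlt =>
      eventTime_lt_eventTime hF h.1 h'.1 (h.2.trans h'.2.symm) hlt
  · simp only [Option.filter_eq_some_iff]
    rintro t e ⟨he, hp⟩
    obtain ⟨m, hm, rfl⟩ := exists_eventTime_eq (F := F) he
    exact ⟨m, ⟨hm, hp⟩, rfl⟩

theorem sc (hF : ∀ x y, F.proc x = F.proc y → F.invTime x < F.invTime y → x < y)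
    (hreads : F.ReadsLastWritten) :
    History.SC (compact s) :=
  ⟨F.sequentialHistory, hreads.legal_sequentialHistory, sequentialHistory_equivalent hF⟩

end OperationFamily

end Criterion

/-! ### Messages and pending operations -/

section Messages

variable {X : Type*} {n : ℕ}

/-- The logical time in a timestamp-value pair. -/
def tsvTime (τ : TSV) : ℕ := (ofLex (ofLex τ).1).1

/-- The timestamp-value pair that is stored initially for every register. -/
def initTSV : TSV := toLex (toLex (0, 0), 0)

/-- The timestamp-value pair of a write of `v` invoked by process `i` at logical time `l`. -/
def writeTSV (l : ℕ) (i : Fin n) (v : ℤ) : TSV := toLex (toLex (l, pid i), v)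

/-- The register that an operation accesses. -/
def Op.reg : Op X → X
  | .read r => r
  | .write r _ => r

/-- The request identifier in a message. -/
def Msg.rid : Msg X → ℕ
  | .query _ rid _ => rid
  | .response _ rid _ => rid
  | .update _ rid _ _ => rid
  | .ack _ rid => rid

/-- Queries and updates are requests; responses and acks are answers. -/
def Msg.isRequest : Msg X → Bool
  | .query _ _ _ => true
  | .response _ _ _ => false
  | .update _ _ _ _ => true
  | .ack _ _ => false

namespace Packet

/-- The process whose operation a packet belongs to: it sends requests and receives answers. -/
def client (m : Packet X n) : Fin n := bif m.msg.isRequest then m.src else m.dst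

/-- The process that a request is addressed to, or that an answer comes from. -/
def server (m : Packet X n) : Fin n := bif m.msg.isRequest then m.dst else m.src

/-- The packet is the request with identifier `ρ` from the client `i` to the server `j`, or an
answer to it. -/
def InSlot (i j : Fin n) (ρ : ℕ) (m : Packet X n) : Prop :=
  m.client = i ∧ m.server = j ∧ m.msg.rid = ρ

instance (i j : Fin n) (ρ : ℕ) : DecidablePred (InSlot (X := X) i j ρ) := fun m =>
  inferInstanceAs (Decidable (m.client = i ∧ m.server = j ∧ m.msg.rid = ρ))

end Packet

section Slots

variable {i j : Fin n} {ρ : ℕ} {m : Packet X n} {M : Msg X} {S T : Multiset (Packet X n)}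

/-- The number of packets in `T` that are the request `ρ` from `i` to `j` or an answer to it. -/
def slotCount (i j : Fin n) (ρ : ℕ) (T : Multiset (Packet X n)) : ℕ :=
  T.countP (Packet.InSlot i j ρ)

theorem slotCount_add : slotCount i j ρ (S + T) = slotCount i j ρ S + slotCount i j ρ T :=
  Multiset.countP_add _ _ _

theorem slotCount_singleton : slotCount i j ρ {m} = if m.InSlot i j ρ then 1 else 0 := by
  rw [slotCount, Multiset.countP_eq_card_filter, Multiset.filter_singleton]
  split_ifs <;> rfl

theorem slotCount_eq_zero (h : ∀ m ∈ T, ¬ m.InSlot i j ρ) : slotCount i j ρ T = 0 :=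
  Multiset.countP_eq_zero.2 h

theorem slotCount_pos : 0 < slotCount i j ρ T ↔ ∃ m ∈ T, m.InSlot i j ρ :=
  Multiset.countP_pos

theorem mem_bcast : m ∈ bcast i M ↔ ∃ j, m = ⟨i, j, M⟩ := by
  simp [bcast, eq_comm]

theorem client_of_mem_bcast (hM : M.isRequest = true) (hm : m ∈ bcast i M) : m.client = i := by
  obtain ⟨j, rfl⟩ := mem_bcast.1 hm
  simp [Packet.client, hM]

theorem slotCount_bcast (hM : M.isRequest = true) :
    slotCount i j M.rid (bcast i M) = 1 := by
  have hslot : ∀ k : Fin n, Packet.InSlot i j M.rid ⟨i, k, M⟩ ↔ k = j := fun k => by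
    simp [Packet.InSlot, Packet.client, Packet.server, hM]
  rw [slotCount, bcast, Multiset.countP_map]
  simp only [hslot]
  rw [← Finset.filter_val, Finset.card_val, Finset.filter_eq', if_pos (Finset.mem_univ j),
    Finset.card_singleton]

end Slots

end Messages

section Facts

variable {X : Type*} {n : ℕ}

namespace Execution

/-- The local state of process `i` at time `t`. -/
abbrev proc (E : Execution X n) (t : ℕ) (i : Fin n) : ProcState X n := (E.config t).procs i

/-- `τ` is the initial pair or the pair of a write to `r`. -/
def Known (E : Execution X n) (r : X) (τ : TSV) : Prop :=
  τ = initTSV ∨ ∃ t i v, E.event t = some (.inv i (.write r v)) ∧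
    τ = writeTSV (E.proc (t + 1) i).lt i v

/-- At some time when its clock is greater than `l`, process `j` stores at most `τ` for `r`. -/
def Sampled (E : Execution X n) (l : ℕ) (j : Fin n) (r : X) (τ : TSV) : Prop :=
  ∃ u, l < (E.proc u j).lt ∧ (E.proc u j).tvps r ≤ τ

/-- At some time when its clock is at most `l`, process `j` stores at least `τ` for `r`. -/
def Secured (E : Execution X n) (l : ℕ) (j : Fin n) (r : X) (τ : TSV) : Prop :=
  ∃ u, (E.proc u j).lt ≤ l ∧ τ ≤ (E.proc u j).tvps r

/-- The last event of `i` before time `t` is the invocation of `o` at time `t₀`. -/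
structure Pending (E : Execution X n) (t₀ : ℕ) (i : Fin n) (o : Op X) (t : ℕ) : Prop where
  lt : t₀ < t
  inv : E.event t₀ = some (.inv i o)
  proc_ne : ∀ u e, t₀ < u → u < t → E.event u = some e → e.proc ≠ i

variable {E : Execution X n} {l l' t t₀ t₁ : ℕ} {i j : Fin n} {r : X} {τ : TSV} {o o' : Op X}

theorem Secured.mono (h : E.Secured l j r τ) (hl : l ≤ l') : E.Secured l' j r τ :=
  let ⟨u, hu, hτ⟩ := h
  ⟨u, hu.trans hl, hτ⟩

theorem pending_succ_self (h : E.event t = some (.inv i o)) : E.Pending t i o (t + 1) :=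
  ⟨t.lt_succ_self, h, fun u _ hu hu' => by omega⟩

theorem Pending.succ (h : E.Pending t₀ i o t) (he : ∀ e, E.event t = some e → e.proc ≠ i) :
    E.Pending t₀ i o (t + 1) := by
  refine ⟨h.lt.trans t.lt_succ_self, h.inv, fun u e hu hu' hue => ?_⟩
  rcases (Nat.lt_succ_iff.1 hu').eq_or_lt with rfl | hlt
  · exact he e hue
  · exact h.proc_ne u e hu hlt hue

theorem Pending.unique (h : E.Pending t₀ i o t) (h' : E.Pending t₁ i o' t) :
    t₀ = t₁ ∧ o = o' := by
  obtain rfl : t₀ = t₁ := by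
    rcases lt_trichotomy t₀ t₁ with hlt | heq | hlt
    · exact absurd rfl (h.proc_ne t₁ _ hlt h'.lt h'.inv)
    · exact heq
    · exact absurd rfl (h'.proc_ne t₀ _ hlt h.lt h.inv)
  have hinv := h.inv.symm.trans h'.inv
  rw [Option.some.injEq, Event.inv.injEq] at hinv
  exact ⟨rfl, hinv.2⟩

end Execution

end Facts

/-! ### Handlers and steps -/

section StepAnalysis

variable {X : Type*} {n : ℕ} {i j : Fin n} {s : ProcState X n} {l rid : ℕ} {τ : TSV} {M : Msg X}

section Handlers

theorem onReceive_response_of_ne (h : s.rid ≠ rid) :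
    onReceive i s j (.response l rid τ) = { state := s, sends := 0, ret := none } :=
  if_neg h

theorem onReceive_response_of_card_ne (h : s.rid = rid)
    (hq : (insert (toLex (τ, j)) s.responses).card ≠ quorum n) :
    onReceive i s j (.response l rid τ) =
      { state := { s with
          lt := max s.lt l + 1
          responses := insert (toLex (τ, j)) s.responses }
        sends := 0
        ret := none } :=
  (if_pos h).trans (if_neg hq)

theorem exists_onReceive_response_of_card_eq (h : s.rid = rid)
    (hq : (insert (toLex (τ, j)) s.responses).card = quorum n) :
    ∃ x ∈ insert (toLex (τ, j)) s.responses,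
      (∀ y ∈ insert (toLex (τ, j)) s.responses, y ≤ x) ∧
      onReceive i s j (.response l rid τ) =
        { state := { s with
            lt := max s.lt l + 1
            rval := (ofLex (ofLex x).1).2
            responses := ∅
            rid := s.rid + 1 }
          sends := bcast i (.update (max s.lt l + 1) (s.rid + 1) s.rreg (ofLex x).1)
          ret := none } :=
  ⟨_, Finset.max'_mem _ (Finset.insert_nonempty _ _), fun y hy => Finset.le_max' _ y hy,
    (if_pos h).trans (if_pos hq)⟩

theorem onReceive_ack_of_ne (h : s.rid ≠ rid) :
    onReceive i s j (.ack l rid) = { state := s, sends := 0, ret := none } :=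
  if_neg h

theorem onReceive_ack_of_card_ne (h : s.rid = rid) (hq : (insert j s.acks).card ≠ quorum n) :
    onReceive i s j (.ack l rid) =
      { state := { s with lt := max s.lt l + 1, acks := insert j s.acks }
        sends := 0
        ret := none } :=
  (if_pos h).trans (if_neg hq)

theorem onReceive_ack_of_card_eq (h : s.rid = rid) (hq : (insert j s.acks).card = quorum n) :
    onReceive i s j (.ack l rid) =
      { state := { s with lt := max s.lt l + 1, acks := ∅, rid := s.rid + 1 }
        sends := 0
        ret := some (if s.reading then Ret.value s.rval else Ret.ok) } :=
  (if_pos h).trans (if_pos hq)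

theorem onReceive_ret_eq_some {a : Ret} (h : (onReceive i s j M).ret = some a) :
    ∃ l, M = .ack l s.rid ∧ (insert j s.acks).card = quorum n := by
  cases M with
  | query | update => cases h
  | response =>
    simp only [onReceive] at h
    split_ifs at h
  | ack l rid =>
    by_cases hrid : s.rid = rid
    · by_cases hq : (insert j s.acks).card = quorum n
      · exact ⟨l, by rw [hrid], hq⟩
      · rw [onReceive_ack_of_card_ne hrid hq] at h
        cases h
    · rw [onReceive_ack_of_ne hrid] at h
      cases h

theorem lt_lt_onInvoke (i : Fin n) (s : ProcState X n) (o : Op X) :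
    s.lt < (onInvoke i s o).state.lt := by
  cases o <;> exact s.lt.lt_succ_self

theorem tvps_onInvoke (i : Fin n) (s : ProcState X n) (o : Op X) :
    (onInvoke i s o).state.tvps = s.tvps := by
  cases o <;> rfl

theorem rid_onInvoke (i : Fin n) (s : ProcState X n) (o : Op X) :
    (onInvoke i s o).state.rid = s.rid + 1 := by
  cases o <;> rfl

theorem lt_le_onReceive (i : Fin n) (s : ProcState X n) (j : Fin n) (M : Msg X) :
    s.lt ≤ (onReceive i s j M).state.lt := by
  cases M <;> simp only [onReceive] <;> (try split_ifs) <;> (try simp only) <;> omega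

theorem tvps_le_onReceive (i : Fin n) (s : ProcState X n) (j : Fin n) (M : Msg X) (r : X) :
    s.tvps r ≤ (onReceive i s j M).state.tvps r := by
  cases M with
  | query => exact le_rfl
  | response | ack =>
    simp only [onReceive]
    split_ifs <;> exact le_rfl
  | update l rid r' τ =>
    simp only [onReceive, Function.update_apply]
    split_ifs with h
    · exact h ▸ le_max_left _ _
    · exact le_rfl

theorem rid_le_onReceive (i : Fin n) (s : ProcState X n) (j : Fin n) (M : Msg X) :
    s.rid ≤ (onReceive i s j M).state.rid := by
  cases M <;> simp only [onReceive] <;> (try split_ifs) <;> (try simp only) <;> omega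

end Handlers

namespace Execution

variable (E : Execution X n) {t : ℕ} {k : Fin n} {o : Op X} {m : Packet X n}
  {C rest : Multiset (Packet X n)} {e : Effect X n}

/-- At time `t`, nothing changes but the set of crashed processes. -/
structure Stutters (t : ℕ) : Prop where
  procs_succ : (E.config (t + 1)).procs = (E.config t).procs
  transit_succ : (E.config (t + 1)).transit = (E.config t).transit
  busy_succ : (E.config (t + 1)).busy = (E.config t).busy
  event : E.event t = none

/-- At time `t`, process `k` executes a handler with effect `e`, by which the packets `C` are
consumed and the packets `rest` are left in transit. -/
structure HandlerStep (t : ℕ) (k : Fin n) (C rest : Multiset (Packet X n)) (e : Effect X n) :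
    Prop where
  transit : (E.config t).transit = C + rest
  procs_succ : (E.config (t + 1)).procs = Function.update (E.config t).procs k e.state
  transit_succ : (E.config (t + 1)).transit = rest + e.sends
  event_proc : ∀ ev, E.event t = some ev → ev.proc = k
  busy_succ_of_ne : ∀ i, i ≠ k → (i ∈ (E.config (t + 1)).busy ↔ i ∈ (E.config t).busy)

/-- At time `t`, process `k` invokes `o`, with effect `e`. -/
structure Invokes (t : ℕ) (k : Fin n) (o : Op X) (e : Effect X n) : Prop
    extends E.HandlerStep t k 0 (E.config t).transit e where
  event : E.event t = some (.inv k o)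
  not_busy : k ∉ (E.config t).busy
  busy_succ : k ∈ (E.config (t + 1)).busy

/-- At time `t`, the packet `m` is received, with effect `e`, while `rest` is left in transit. -/
structure Receives (t : ℕ) (m : Packet X n) (rest : Multiset (Packet X n)) (e : Effect X n) : Prop
    extends E.HandlerStep t m.dst {m} rest e where
  event : E.event t = e.ret.map (Event.res m.dst)
  busy_succ : m.dst ∈ (E.config (t + 1)).busy ↔ e.ret = none ∧ m.dst ∈ (E.config t).busy

theorem exists_receives (h : E.step t = .receive m) :
    ∃ rest, E.Receives t m rest (onReceive m.dst (E.proc t m.dst) m.src m.msg) := by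
  have htrans := E.trans t
  rw [h] at htrans
  generalize hc : E.config t = c, hev : E.event t = ev, hc' : E.config (t + 1) = c' at htrans
  cases htrans with
  | receive _ rest hm _ =>
    subst hc
    refine ⟨rest, ⟨hm, by rw [hc'], by rw [hc'], fun ev' h' => ?_, fun i hi' => ?_⟩, hev, ?_⟩
    · obtain ⟨a, -, rfl⟩ := Option.map_eq_some_iff.1 (hev.symm.trans h')
      rfl
    · rw [hc']
      dsimp only
      split_ifs
      · simp [hi']
      · rfl
    · rw [hc']
      dsimp only
      split_ifs with hret
      · simp [Option.isSome_iff_ne_none.1 hret]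
      · simp [Option.not_isSome_iff_eq_none.1 hret]

theorem step_cases (t : ℕ) :
    E.Stutters t ∨ (∃ k o, E.Invokes t k o (onInvoke k (E.proc t k) o)) ∨
      ∃ m rest, E.Receives t m rest (onReceive m.dst (E.proc t m.dst) m.src m.msg) := by
  have htrans := E.trans t
  generalize hc : E.config t = c, hs : E.step t = s, hev : E.event t = ev,
    hc' : E.config (t + 1) = c' at htrans
  cases htrans with
  | idle | crash =>
    subst hc
    exact .inl ⟨by rw [hc'], by rw [hc'], by rw [hc'], hev⟩
  | invoke k o _ hb =>
    subst hc
    refine .inr (.inl ⟨k, o, ⟨(zero_add _).symm, by rw [hc'], by rw [hc'], fun ev' h' => ?_,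
      fun i hi => by rw [hc']; simp [hi]⟩, hev, hb, by rw [hc']; simp⟩)
    obtain rfl := Option.some.inj (hev.symm.trans h')
    rfl
  | receive =>
    exact .inr (.inr ⟨_, E.exists_receives hs⟩)

variable {E}

theorem HandlerStep.proc_succ (h : E.HandlerStep t k C rest e) : E.proc (t + 1) k = e.state := by
  rw [proc, h.procs_succ, Function.update_self]

theorem HandlerStep.proc_succ_of_ne (h : E.HandlerStep t k C rest e) (hi : i ≠ k) :
    E.proc (t + 1) i = E.proc t i := by
  rw [proc, h.procs_succ, Function.update_of_ne hi]

theorem Receives.mem_transit (h : E.Receives t m rest e) : m ∈ (E.config t).transit := by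
  simp [h.transit]

theorem Receives.event_eq_none (h : E.Receives t m rest e) (he : e.ret = none) :
    E.event t = none := by
  rw [h.event, he, Option.map_none]

variable (E)

theorem proc_succ_cases (t : ℕ) (i : Fin n) :
    E.proc (t + 1) i = E.proc t i ∨
      (∃ o, E.proc (t + 1) i = (onInvoke i (E.proc t i) o).state) ∨
      ∃ j M, E.proc (t + 1) i = (onReceive i (E.proc t i) j M).state := by
  rcases E.step_cases t with h | ⟨k, o, h⟩ | ⟨m, rest, h⟩
  · exact .inl (by rw [proc, h.procs_succ])
  · rcases eq_or_ne i k with rfl | hik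
    · exact .inr (.inl ⟨o, h.proc_succ⟩)
    · exact .inl (h.proc_succ_of_ne hik)
  · rcases eq_or_ne i m.dst with rfl | hi
    · exact .inr (.inr ⟨m.src, m.msg, h.proc_succ⟩)
    · exact .inl (h.proc_succ_of_ne hi)

theorem clock_monotone (i : Fin n) : Monotone fun t => (E.proc t i).lt :=
  monotone_nat_of_le_succ fun t => by
    rcases E.proc_succ_cases t i with h | ⟨o, h⟩ | ⟨j, M, h⟩ <;> rw [h]
    · exact (lt_lt_onInvoke _ _ _).le
    · exact lt_le_onReceive _ _ _ _

theorem tvps_monotone (i : Fin n) (r : X) : Monotone fun t => (E.proc t i).tvps r :=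
  monotone_nat_of_le_succ fun t => by
    rcases E.proc_succ_cases t i with h | ⟨o, h⟩ | ⟨j, M, h⟩ <;> rw [h]
    · rw [tvps_onInvoke]
    · exact tvps_le_onReceive _ _ _ _ _

theorem rid_monotone (i : Fin n) : Monotone fun t => (E.proc t i).rid :=
  monotone_nat_of_le_succ fun t => by
    rcases E.proc_succ_cases t i with h | ⟨o, h⟩ | ⟨j, M, h⟩ <;> rw [h]
    · exact (rid_onInvoke _ _ _).ge.trans' (Nat.le_succ _)
    · exact rid_le_onReceive _ _ _ _

end Execution

end StepAnalysis

/-! ### The invariant -/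

section InvariantDefinition

variable {X : Type*} {n : ℕ}

/-- The phases of a process as a client: no outstanding operation, the query phase of a read of `r`
invoked at time `t₀`, and the update phase, with the pair `τ`, of an operation `o` invoked at time
`t₀`. -/
inductive Phase (X : Type*) where
  | idle
  | query (t₀ : ℕ) (r : X)
  | update (t₀ : ℕ) (o : Op X) (τ : TSV)

/-- The processes from which the client has heard in the current phase. -/
def ProcState.responders (s : ProcState X n) : Finset (Fin n) :=
  s.responses.image (fun x => (ofLex x).2) ∪ s.acks

/-- `s'` differs from `s` at most in `tvps` and in a larger clock. -/
structure ProcState.SameClient (s s' : ProcState X n) : Prop where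
  lt_le : s.lt ≤ s'.lt
  rid : s'.rid = s.rid
  responses : s'.responses = s.responses
  acks : s'.acks = s.acks
  reading : s'.reading = s.reading
  rreg : s'.rreg = s.rreg
  rval : s'.rval = s.rval

theorem ProcState.SameClient.refl (s : ProcState X n) : s.SameClient s :=
  ⟨le_rfl, rfl, rfl, rfl, rfl, rfl, rfl⟩

theorem ProcState.SameClient.responders {s s' : ProcState X n} (h : s.SameClient s') :
    s'.responders = s.responders := by
  rw [ProcState.responders, ProcState.responders, h.responses, h.acks]

namespace Execution

variable (E : Execution X n)

/-- What a packet says, if its client is `i`, which is in phase `g` with request identifier `ρ`. -/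
def PacketOK (i : Fin n) (ρ : ℕ) (g : Phase X) : Packet X n → Prop
  | ⟨_, _, .query l rid r⟩ => rid ≤ ρ ∧
      (rid = ρ → ∃ t₀, g = .query t₀ r ∧ (E.proc (t₀ + 1) i).lt ≤ l)
  | ⟨j, _, .response l rid τ⟩ => rid ≤ ρ ∧ tsvTime τ ≤ l ∧
      (rid = ρ → ∃ t₀ r, g = .query t₀ r ∧ E.Known r τ ∧
        E.Sampled (E.proc (t₀ + 1) i).lt j r τ)
  | ⟨_, _, .update l rid r τ⟩ => rid ≤ ρ ∧ tsvTime τ ≤ l ∧ E.Known r τ ∧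
      (rid = ρ → ∃ t₀ o, g = .update t₀ o τ ∧ o.reg = r)
  | ⟨j, _, .ack l rid⟩ => rid ≤ ρ ∧
      (rid = ρ → ∃ t₀ o τ, g = .update t₀ o τ ∧ E.Secured l j o.reg τ)

/-- What holds of the packets `T` in transit for the client `i` in phase `g` with request
identifier `ρ`: as long as it has heard from the processes in `R` only, there is exactly one packet
in transit between the client and every other process that belongs to the current request. -/
structure NetOK (i : Fin n) (ρ : ℕ) (g : Phase X) (R : Finset (Fin n))
    (T : Multiset (Packet X n)) : Prop where
  packets : ∀ m ∈ T, m.client = i → E.PacketOK i ρ g m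
  slots : g ≠ .idle → ∀ j, slotCount i j ρ T + (if j ∈ R then 1 else 0) = 1

/-- What holds of the set `R` of responses to a query for `r` that a client collected after its
clock was `l` and until its clock is `c`. -/
structure Collected (l : ℕ) (r : X) (c : ℕ) (R : Finset (TSV ×ₗ Fin n)) : Prop where
  injOn : Set.InjOn (fun x => (ofLex x).2) (R : Set (TSV ×ₗ Fin n))
  known : ∀ x ∈ R, E.Known r (ofLex x).1
  time_le : ∀ x ∈ R, tsvTime (ofLex x).1 ≤ c
  sampled : ∀ x ∈ R, E.Sampled l (ofLex x).2 r (ofLex x).1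

/-- The local state of the client `i` in the query phase of a read of `r` invoked at `t₀`. -/
structure QueryState (i : Fin n) (t₀ : ℕ) (r : X) (s : ProcState X n) : Prop where
  rid : s.rid = (E.proc (t₀ + 1) i).rid
  reading : s.reading = true
  rreg : s.rreg = r
  acks : s.acks = ∅
  card_lt : s.responses.card < quorum n
  collected : E.Collected (E.proc (t₀ + 1) i).lt r s.lt s.responses

/-- The local state of the client `i` in the update phase, with the pair `τ`, of an operation `o`
invoked at `t₀`. -/
structure UpdateState (i : Fin n) (t₀ : ℕ) (o : Op X) (τ : TSV) (s : ProcState X n) : Prop where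
  rid_le : s.rid ≤ (E.proc (t₀ + 1) i).rid + 1
  responses : s.responses = ∅
  known : E.Known o.reg τ
  time_le : tsvTime τ ≤ s.lt
  card_lt : s.acks.card < quorum n
  secured : ∀ j ∈ s.acks, E.Secured s.lt j o.reg τ
  read : ∀ r, o = .read r → s.reading = true ∧ s.rval = (ofLex τ).2 ∧
    ∃ Q : Finset (Fin n), Q.card = quorum n ∧ ∀ j ∈ Q, E.Sampled (E.proc (t₀ + 1) i).lt j r τ
  write : ∀ r v, o = .write r v → s.reading = false ∧ τ = writeTSV (E.proc (t₀ + 1) i).lt i v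

/-- The local state of the client `i` in phase `g`. -/
def LocalState (i : Fin n) (s : ProcState X n) : Phase X → Prop
  | .idle => s.responses = ∅ ∧ s.acks = ∅
  | .query t₀ r => E.QueryState i t₀ r s
  | .update t₀ o τ => E.UpdateState i t₀ o τ s

/-- The operation of phase `g` is the pending operation of process `i` at time `t`. -/
def PhasePending (i : Fin n) (t : ℕ) : Phase X → Prop
  | .idle => True
  | .query t₀ r => E.Pending t₀ i (.read r) t
  | .update t₀ o _ => E.Pending t₀ i o t

/-- The invariant for the client `i` in phase `g` at time `t`. -/
structure ClientInv (t : ℕ) (i : Fin n) (g : Phase X) : Prop where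
  busy : i ∈ (E.config t).busy ↔ g ≠ .idle
  pending : E.PhasePending i t g
  state : E.LocalState i (E.proc t i) g
  net : E.NetOK i (E.proc t i).rid g (E.proc t i).responders (E.config t).transit

/-- What holds of the pairs that a process in local state `s` stores. -/
structure ServerState (s : ProcState X n) : Prop where
  known : ∀ r, E.Known r (s.tvps r)
  time_le : ∀ r, tsvTime (s.tvps r) ≤ s.lt

/-- The invariant of the algorithm. -/
structure Invariant (t : ℕ) : Prop where
  server : ∀ j, E.ServerState (E.proc t j)
  client : ∀ i, ∃ g, E.ClientInv t i g

theorem invariant_zero : E.Invariant 0 := by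
  obtain ⟨hprocs, htransit, hbusy, -⟩ := E.initial
  refine ⟨fun j => ⟨fun r => .inl ((hprocs j).2.2.1 r), fun r => ?_⟩,
    fun i => ⟨.idle, by simp [hbusy], trivial, (hprocs i).2.2.2, by simp [htransit], by simp⟩⟩
  rw [(hprocs j).2.2.1 r]
  exact Nat.zero_le _

variable {E} {t t₀ ρ l l' c c' : ℕ} {i j k : Fin n} {g g' : Phase X} {r : X} {o : Op X} {τ : TSV}
  {R : Finset (Fin n)} {T T' : Multiset (Packet X n)} {m : Packet X n} {M : Msg X}
  {s s' : ProcState X n}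

section Packets

theorem PacketOK.rid_le (h : E.PacketOK i ρ g m) : m.msg.rid ≤ ρ := by
  obtain ⟨_, _, _ | _ | _ | _⟩ := m <;> exact h.1

theorem PacketOK.succ (h : E.PacketOK i ρ g m) : E.PacketOK i (ρ + 1) g' m := by
  have hlt : m.msg.rid < ρ + 1 := Nat.lt_succ_of_le h.rid_le
  obtain ⟨_, _, _ | _ | _ | _⟩ := m
  · exact ⟨hlt.le, fun heq => absurd heq hlt.ne⟩
  · exact ⟨hlt.le, h.2.1, fun heq => absurd heq hlt.ne⟩
  · exact ⟨hlt.le, h.2.1, h.2.2.1, fun heq => absurd heq hlt.ne⟩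
  · exact ⟨hlt.le, fun heq => absurd heq hlt.ne⟩

theorem NetOK.replace (h : E.NetOK i ρ g R T)
    (hp : ∀ m ∈ T', m.client = i → m ∈ T ∨ E.PacketOK i ρ g m)
    (hc : ∀ j, slotCount i j ρ T' = slotCount i j ρ T) : E.NetOK i ρ g R T' where
  packets m hm hi := (hp m hm hi).elim (fun h' => h.packets m h' hi) id
  slots hg j := by rw [hc]; exact h.slots hg j

theorem NetOK.broadcast (h : E.NetOK i ρ g R T) (hM : M.isRequest = true) (hrid : M.rid = ρ + 1)
    (hT : ∀ m ∈ T', m ∈ T) (hp : ∀ j, E.PacketOK i (ρ + 1) g' ⟨i, j, M⟩) :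
    E.NetOK i (ρ + 1) g' ∅ (T' + bcast i M) where
  packets m hm hi := by
    rcases Multiset.mem_add.1 hm with hm | hm
    · exact (h.packets m (hT m hm) hi).succ
    · obtain ⟨j, rfl⟩ := mem_bcast.1 hm
      exact hp j
  slots _ j := by
    have hfresh : slotCount i j (ρ + 1) T' = 0 := slotCount_eq_zero fun m hm ⟨hi, _, hr⟩ => by
      have := (h.packets m (hT m hm) hi).rid_le
      omega
    rw [slotCount_add, hfresh, ← hrid, slotCount_bcast hM, if_neg (Finset.notMem_empty j)]

theorem NetOK.finish (h : E.NetOK i ρ g R T) (R' : Finset (Fin n)) (hT : ∀ m ∈ T', m ∈ T) :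
    E.NetOK i (ρ + 1) .idle R' T' where
  packets m hm hi := (h.packets m (hT m hm) hi).succ
  slots hg := absurd rfl hg

theorem NetOK.notMem_of_inSlot (h : E.NetOK i ρ g R T) (hg : g ≠ .idle) (hm : m ∈ T)
    (hs : m.InSlot i j ρ) : j ∉ R := fun hj => by
  have hslots := h.slots hg j
  have hpos := slotCount_pos.2 ⟨m, hm, hs⟩
  rw [if_pos hj] at hslots
  omega

theorem NetOK.hear (h : E.NetOK i ρ g R ({m} + T)) (hg : g ≠ .idle) (hs : m.InSlot i j ρ) :
    E.NetOK i ρ g (insert j R) T where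
  packets m' hm' := h.packets m' (Multiset.mem_add.2 (.inr hm'))
  slots _ k := by
    have hslots := h.slots hg k
    rw [slotCount_add, slotCount_singleton] at hslots
    rcases eq_or_ne k j with rfl | hkj
    · rw [if_pos hs] at hslots
      rw [if_pos (Finset.mem_insert_self k R)]
      omega
    · rw [if_neg fun h' => hkj (h'.2.1.symm.trans hs.2.1)] at hslots
      simpa [hkj] using hslots

end Packets

section Collected

variable {Q : Finset (TSV ×ₗ Fin n)}

theorem Sampled.mono {τ' : TSV} (h : E.Sampled l j r τ) (hτ : τ ≤ τ') : E.Sampled l j r τ' :=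
  let ⟨u, hu, hle⟩ := h
  ⟨u, hu, hle.trans hτ⟩

theorem collected_empty : E.Collected l r c ∅ := by
  constructor <;> simp

theorem Collected.mono (h : E.Collected l r c Q) (hc : c ≤ c') : E.Collected l r c' Q :=
  { h with time_le := fun x hx => (h.time_le x hx).trans hc }

theorem Collected.insert (h : E.Collected l r c Q) (hj : j ∉ Q.image fun x => (ofLex x).2)
    (hknown : E.Known r τ) (htime : tsvTime τ ≤ c) (hsampled : E.Sampled l j r τ) :
    E.Collected l r c (insert (toLex (τ, j)) Q) where
  injOn := by
    have hnot : toLex (τ, j) ∉ Q := fun h' => hj (Finset.mem_image_of_mem _ h')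
    rw [Finset.coe_insert, Set.injOn_insert (Finset.mem_coe.not.2 hnot)]
    exact ⟨h.injOn, by simpa using hj⟩
  known := Finset.forall_mem_insert _ _ _ |>.2 ⟨hknown, h.known⟩
  time_le := Finset.forall_mem_insert _ _ _ |>.2 ⟨htime, h.time_le⟩
  sampled := Finset.forall_mem_insert _ _ _ |>.2 ⟨hsampled, h.sampled⟩

theorem Collected.exists_quorum {x : TSV ×ₗ Fin n} (h : E.Collected l r c Q)
    (hQ : Q.card = quorum n) (hx : ∀ y ∈ Q, y ≤ x) :
    ∃ S : Finset (Fin n), S.card = quorum n ∧ ∀ j ∈ S, E.Sampled l j r (ofLex x).1 := by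
  refine ⟨Q.image fun y => (ofLex y).2, (Finset.card_image_of_injOn h.injOn).trans hQ, ?_⟩
  rw [Finset.forall_mem_image]
  exact fun y hy => (h.sampled y hy).mono (Prod.Lex.monotone_fst _ _ (hx y hy))

end Collected

theorem LocalState.sameClient (h : E.LocalState i s g) (hs : s.SameClient s') :
    E.LocalState i s' g := by
  cases g with
  | idle => exact ⟨hs.responses.trans h.1, hs.acks.trans h.2⟩
  | query t₀ r =>
    have h : E.QueryState i t₀ r s := h
    exact
      { rid := hs.rid.trans h.rid
        reading := hs.reading.trans h.reading
        rreg := hs.rreg.trans h.rreg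
        acks := hs.acks.trans h.acks
        card_lt := hs.responses ▸ h.card_lt
        collected := hs.responses ▸ h.collected.mono hs.lt_le : E.QueryState i t₀ r s' }
  | update t₀ o τ =>
    have h : E.UpdateState i t₀ o τ s := h
    exact
      { rid_le := hs.rid ▸ h.rid_le
        responses := hs.responses.trans h.responses
        known := h.known
        time_le := h.time_le.trans hs.lt_le
        card_lt := hs.acks ▸ h.card_lt
        secured := fun j hj => (h.secured j (hs.acks ▸ hj)).mono hs.lt_le
        read := by simpa only [hs.reading, hs.rval] using h.read
        write := by simpa only [hs.reading] using h.write : E.UpdateState i t₀ o τ s' }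

theorem PhasePending.succ (h : E.PhasePending i t g)
    (he : ∀ e, E.event t = some e → e.proc ≠ i) : E.PhasePending i (t + 1) g := by
  cases g with
  | idle => trivial
  | query | update => exact Pending.succ h he

theorem ServerState.mono (h : E.ServerState s) (htvps : s'.tvps = s.tvps) (hlt : s.lt ≤ s'.lt) :
    E.ServerState s' := by
  constructor <;> rw [htvps]
  · exact h.known
  · exact fun r => (h.time_le r).trans hlt

theorem ClientInv.eq_idle (h : E.ClientInv t i g) (hi : i ∉ (E.config t).busy) : g = .idle :=
  not_not.1 fun hg => hi (h.busy.2 hg)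

end Execution

end InvariantDefinition

section ServerSteps

theorem quorum_pos (n : ℕ) : 0 < quorum n := Nat.succ_pos _

variable {X : Type*} {n : ℕ}

namespace Execution

variable {E : Execution X n} {t : ℕ} {i k : Fin n} {g : Phase X} {o : Op X} {m m' : Packet X n}
  {C rest : Multiset (Packet X n)} {e : Effect X n} {s' : ProcState X n}

section FrameConditions

theorem ClientInv.of_sameClient (h : E.ClientInv t i g)
    (hs : (E.proc t i).SameClient (E.proc (t + 1) i))
    (hb : i ∈ (E.config (t + 1)).busy ↔ i ∈ (E.config t).busy)
    (he : ∀ e, E.event t = some e → e.proc ≠ i)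
    (hp : ∀ m ∈ (E.config (t + 1)).transit, m.client = i →
      m ∈ (E.config t).transit ∨ E.PacketOK i (E.proc t i).rid g m)
    (hc : ∀ j, slotCount i j (E.proc t i).rid (E.config (t + 1)).transit =
      slotCount i j (E.proc t i).rid (E.config t).transit) :
    E.ClientInv (t + 1) i g where
  busy := hb.trans h.busy
  pending := h.pending.succ he
  state := h.state.sameClient hs
  net := by
    rw [hs.rid, hs.responders]
    exact h.net.replace hp hc

theorem Invariant.of_stutters (h : E.Invariant t) (hst : E.Stutters t) : E.Invariant (t + 1) where
  server j := by
    rw [proc, hst.procs_succ]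
    exact h.server j
  client i := by
    obtain ⟨g, hg⟩ := h.client i
    refine ⟨g, hg.of_sameClient ?_ (by rw [hst.busy_succ]) (by simp [hst.event]) ?_ ?_⟩
    · rw [proc, proc, hst.procs_succ]
      exact .refl _
    · rw [hst.transit_succ]
      exact fun m hm _ => .inl hm
    · rw [hst.transit_succ]
      exact fun _ => rfl

theorem HandlerStep.serverState (hstep : E.HandlerStep t k C rest e) (h : E.Invariant t)
    (hs : E.ServerState e.state) (j : Fin n) : E.ServerState (E.proc (t + 1) j) := by
  rcases eq_or_ne j k with rfl | hjk
  · rwa [hstep.proc_succ]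
  · rw [hstep.proc_succ_of_ne hjk]
    exact h.server j

theorem HandlerStep.clientInv_of_ne (hstep : E.HandlerStep t k C rest e)
    (h : E.ClientInv t i g) (hik : i ≠ k) (hC : ∀ m ∈ C, m.client = k)
    (hS : ∀ m ∈ e.sends, m.client = k) : E.ClientInv (t + 1) i g := by
  refine h.of_sameClient ?_ (hstep.busy_succ_of_ne i hik)
    (fun ev hev hi => hik (hi.symm.trans (hstep.event_proc ev hev))) (fun m hm hi => ?_)
    fun j => ?_
  · rw [hstep.proc_succ_of_ne hik]
    exact .refl _
  · rw [hstep.transit_succ, Multiset.mem_add] at hm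
    rw [hstep.transit, Multiset.mem_add]
    exact .inl (.inr (hm.resolve_right fun h' => hik (hi.symm.trans (hS m h'))))
  · rw [hstep.transit, hstep.transit_succ, slotCount_add, slotCount_add,
      slotCount_eq_zero fun m hm h' => hik (h'.1.symm.trans (hC m hm)),
      slotCount_eq_zero fun m hm h' => hik (h'.1.symm.trans (hS m hm)), add_comm]

theorem Invariant.of_clientStep (h : E.Invariant t) (hstep : E.HandlerStep t k C rest e)
    (hC : ∀ m ∈ C, m.client = k) (hS : ∀ m ∈ e.sends, m.client = k)
    (hserver : E.ServerState e.state) (hclient : E.ClientInv (t + 1) k g) :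
    E.Invariant (t + 1) where
  server := hstep.serverState h hserver
  client i := by
    rcases eq_or_ne i k with rfl | hik
    · exact ⟨g, hclient⟩
    · obtain ⟨g', hg'⟩ := h.client i
      exact ⟨g', hstep.clientInv_of_ne hg' hik hC hS⟩

theorem HandlerStep.clientInv (hstep : E.HandlerStep t k C rest e)
    (hb : k ∈ (E.config (t + 1)).busy ↔ g ≠ .idle) (hp : E.PhasePending k (t + 1) g)
    (hs : E.LocalState k e.state g)
    (hn : E.NetOK k e.state.rid g e.state.responders (rest + e.sends)) :
    E.ClientInv (t + 1) k g where
  busy := hb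
  pending := hp
  state := by rwa [hstep.proc_succ]
  net := by rwa [hstep.proc_succ, hstep.transit_succ]

theorem Receives.event_ne (hr : E.Receives t m rest e) (he : e.ret = none) (ev : Event X n)
    (hev : E.event t = some ev) : ev.proc ≠ i := by
  rw [hr.event_eq_none he] at hev
  cases hev

end FrameConditions

section Requests

theorem Invariant.of_answer (h : E.Invariant t)
    (hr : E.Receives t m rest { state := s', sends := {m'}, ret := none })
    (hs : (E.proc t m.dst).SameClient s') (hstate : E.ServerState s')
    (hclient : m'.client = m.client) (hserver : m'.server = m.server)
    (hrid : m'.msg.rid = m.msg.rid)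
    (hm : ∀ i g, m.client = i → E.ClientInv t i g → E.PacketOK i (E.proc t i).rid g m') :
    E.Invariant (t + 1) where
  server := hr.serverState h hstate
  client i := by
    obtain ⟨g, hg⟩ := h.client i
    refine ⟨g, hg.of_sameClient ?_ ?_ (hr.event_ne rfl) (fun p hp hi => ?_) fun j => ?_⟩
    · rcases eq_or_ne i m.dst with rfl | hi
      · rwa [hr.proc_succ]
      · rw [hr.proc_succ_of_ne hi]
        exact .refl _
    · rcases eq_or_ne i m.dst with rfl | hi
      · simp [hr.busy_succ]
      · exact hr.busy_succ_of_ne i hi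
    · rw [hr.transit_succ, Multiset.mem_add, Multiset.mem_singleton] at hp
      rcases hp with hp | rfl
      · exact .inl (hr.transit ▸ Multiset.mem_add.2 (.inr hp))
      · exact .inr (hm i g (hclient.symm.trans hi) hg)
    · have hslot : m'.InSlot i j (E.proc t i).rid ↔ m.InSlot i j (E.proc t i).rid := by
        rw [Packet.InSlot, Packet.InSlot, hclient, hserver, hrid]
      rw [hr.transit, hr.transit_succ, slotCount_add, slotCount_add, slotCount_singleton,
        slotCount_singleton, if_congr hslot rfl rfl, add_comm]

variable {j : Fin n} {l rid : ℕ} {r : X} {τ : TSV}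

theorem Invariant.receive_query (h : E.Invariant t)
    (hr : E.Receives t ⟨j, k, .query l rid r⟩ rest
      (onReceive k (E.proc t k) j (.query l rid r))) : E.Invariant (t + 1) := by
  have hle : (E.proc t k).lt ≤ max (E.proc t k).lt l + 1 := by omega
  refine h.of_answer hr ⟨hle, rfl, rfl, rfl, rfl, rfl, rfl⟩ ((h.server k).mono rfl hle)
    rfl rfl rfl fun i g hi hg => ?_
  obtain ⟨hrid, hcur⟩ := hg.net.packets _ hr.mem_transit hi
  refine ⟨hrid, ((h.server k).time_le r).trans hle, fun heq => ?_⟩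
  obtain ⟨t₀, rfl, hl⟩ := hcur heq
  refine ⟨t₀, r, rfl, (h.server k).known r, t + 1, ?_⟩
  rw [hr.proc_succ]
  exact ⟨Nat.lt_succ_of_le (hl.trans (le_max_right _ _)), le_rfl⟩

theorem ServerState.receive_update {s : ProcState X n} (h : E.ServerState s) (k j : Fin n)
    (rid : ℕ) (hknown : E.Known r τ) (htime : tsvTime τ ≤ l) :
    E.ServerState (onReceive k s j (.update l rid r τ)).state := by
  have hboth : ∀ r', E.Known r' ((onReceive k s j (.update l rid r τ)).state.tvps r') ∧
      tsvTime ((onReceive k s j (.update l rid r τ)).state.tvps r') ≤ max s.lt l + 1 := fun r' => by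
    have hold := h.time_le r'
    simp only [onReceive, Function.update_apply]
    split_ifs with hr'
    · subst hr'
      rcases max_choice (s.tvps r') τ with hmax | hmax <;> rw [hmax]
      · exact ⟨h.known r', by omega⟩
      · exact ⟨hknown, by omega⟩
    · exact ⟨h.known r', by omega⟩
  exact ⟨fun r' => (hboth r').1, fun r' => (hboth r').2⟩

theorem Invariant.receive_update (h : E.Invariant t)
    (hr : E.Receives t ⟨j, k, .update l rid r τ⟩ rest
      (onReceive k (E.proc t k) j (.update l rid r τ))) : E.Invariant (t + 1) := by
  have hle : (E.proc t k).lt ≤ max (E.proc t k).lt l + 1 := by omega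
  obtain ⟨g, hg⟩ := h.client j
  obtain ⟨-, htime, hknown, -⟩ := hg.net.packets _ hr.mem_transit rfl
  refine h.of_answer hr ⟨hle, rfl, rfl, rfl, rfl, rfl, rfl⟩
    ((h.server k).receive_update k j rid hknown htime) rfl rfl rfl fun i g hi hg => ?_
  obtain ⟨hrid, -, -, hcur⟩ := hg.net.packets _ hr.mem_transit hi
  refine ⟨hrid, fun heq => ?_⟩
  obtain ⟨t₀, o, rfl, rfl⟩ := hcur heq
  refine ⟨t₀, o, τ, rfl, t + 1, ?_⟩
  rw [hr.proc_succ]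
  exact ⟨le_rfl, by simp [onReceive]⟩

end Requests

section Invocations

theorem Invokes.clientInv_read {r : X}
    (h : E.Invokes t k (.read r) (onInvoke k (E.proc t k) (.read r)))
    (hidle : E.ClientInv t k .idle) : E.ClientInv (t + 1) k (.query t r) := by
  obtain ⟨hresp, hacks⟩ := hidle.state
  refine h.clientInv (by simp [h.busy_succ]) (pending_succ_self h.event) ?_ ?_
  · exact
      { rid := by rw [h.proc_succ]
        reading := rfl
        rreg := rfl
        acks := hacks
        card_lt := by simpa [onInvoke, hresp] using quorum_pos n
        collected := hresp ▸ collected_empty :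
          E.QueryState k t r (onInvoke k (E.proc t k) (.read r)).state }
  · have hnone : (onInvoke k (E.proc t k) (.read r)).state.responders = ∅ := by
      simp [onInvoke, ProcState.responders, hresp, hacks]
    rw [hnone]
    exact hidle.net.broadcast rfl rfl (fun _ => id) fun _ =>
      ⟨le_rfl, fun _ => ⟨t, rfl, by rw [h.proc_succ]; rfl⟩⟩

theorem Invokes.clientInv_write {r : X} {v : ℤ}
    (h : E.Invokes t k (.write r v) (onInvoke k (E.proc t k) (.write r v)))
    (hidle : E.ClientInv t k .idle) :
    E.ClientInv (t + 1) k (.update t (.write r v) (writeTSV (E.proc (t + 1) k).lt k v)) := by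
  obtain ⟨hresp, hacks⟩ := hidle.state
  have hknown : E.Known r (writeTSV (E.proc (t + 1) k).lt k v) := .inr ⟨t, k, v, h.event, rfl⟩
  have hlt : (E.proc (t + 1) k).lt = (E.proc t k).lt + 1 := by
    rw [h.proc_succ]
    rfl
  refine h.clientInv (by simp [h.busy_succ]) (pending_succ_self h.event) ?_ ?_
  · exact
      { rid_le := by rw [h.proc_succ]; exact Nat.le_succ _
        responses := hresp
        known := hknown
        time_le := hlt.le
        card_lt := by simpa [onInvoke, hacks] using quorum_pos n
        secured := by simp [onInvoke, hacks]
        read := fun r' hr' => by cases hr'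
        write := fun r' v' hv' => by cases hv'; exact ⟨rfl, rfl⟩ :
          E.UpdateState k t (.write r v) _ (onInvoke k (E.proc t k) (.write r v)).state }
  · have hnone : (onInvoke k (E.proc t k) (.write r v)).state.responders = ∅ := by
      simp [onInvoke, ProcState.responders, hresp, hacks]
    rw [hnone, hlt]
    exact hidle.net.broadcast rfl rfl (fun _ => id) fun _ =>
      ⟨le_rfl, le_rfl, hlt ▸ hknown, fun _ => ⟨t, _, rfl, rfl⟩⟩

theorem Invariant.invoke (h : E.Invariant t) (hk : E.Invokes t k o (onInvoke k (E.proc t k) o)) :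
    E.Invariant (t + 1) := by
  obtain ⟨g, hg⟩ := h.client k
  obtain rfl := hg.eq_idle hk.not_busy
  have hserver : E.ServerState (onInvoke k (E.proc t k) o).state :=
    (h.server k).mono (tvps_onInvoke _ _ _) (lt_lt_onInvoke _ _ _).le
  cases o with
  | read r =>
    exact h.of_clientStep hk.toHandlerStep (by simp) (fun m => client_of_mem_bcast rfl) hserver
      (hk.clientInv_read hg)
  | write r v =>
    exact h.of_clientStep hk.toHandlerStep (by simp) (fun m => client_of_mem_bcast rfl) hserver
      (hk.clientInv_write hg)

end Invocations

end Execution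

end ServerSteps

section ClientSteps

variable {X : Type*} {n : ℕ}

namespace Execution

variable {E : Execution X n} {t t₀ l rid : ℕ} {j k : Fin n} {g : Phase X} {r : X} {o : Op X}
  {τ : TSV} {M : Msg X} {s : ProcState X n} {m : Packet X n} {rest : Multiset (Packet X n)}
  {e : Effect X n}

theorem Receives.busy_succ_iff_ne_idle {g' : Phase X} (hr : E.Receives t m rest e)
    (he : e.ret = none) (hg : E.ClientInv t m.dst g) (hne : g ≠ .idle) (hne' : g' ≠ .idle) :
    m.dst ∈ (E.config (t + 1)).busy ↔ g' ≠ .idle :=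
  iff_of_true (hr.busy_succ.2 ⟨he, hg.busy.2 hne⟩) hne'

theorem Invariant.receive_stale (h : E.Invariant t) (hM : M.isRequest = false)
    (hrid : (E.proc t k).rid ≠ M.rid)
    (hr : E.Receives t ⟨j, k, M⟩ rest { state := E.proc t k, sends := 0, ret := none }) :
    E.Invariant (t + 1) := by
  have hclient : (⟨j, k, M⟩ : Packet X n).client = k := by simp [Packet.client, hM]
  obtain ⟨g, hg⟩ := h.client k
  refine h.of_clientStep hr.toHandlerStep (by simpa using hclient) (by simp) (h.server k)
    (hg.of_sameClient ?_ (by simp [hr.busy_succ]) (hr.event_ne rfl) ?_ fun i => ?_)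
  · rw [hr.proc_succ]
    exact .refl _
  · rw [hr.transit, hr.transit_succ, add_zero]
    exact fun m hm _ => .inl (Multiset.mem_add.2 (.inr hm))
  · rw [hr.transit, hr.transit_succ, add_zero, slotCount_add, slotCount_singleton,
      if_neg fun hs => hrid hs.2.2.symm, zero_add]

section Responses

theorem ClientInv.exists_query (hg : E.ClientInv t k g)
    (hm : ⟨j, k, .response l (E.proc t k).rid τ⟩ ∈ (E.config t).transit) :
    ∃ t₀ r, g = .query t₀ r ∧
      E.Collected (E.proc (t₀ + 1) k).lt r (max (E.proc t k).lt l + 1)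
        (insert (toLex (τ, j)) (E.proc t k).responses) := by
  obtain ⟨-, htime, hcur⟩ := hg.net.packets _ hm rfl
  obtain ⟨t₀, r, rfl, hknown, hsampled⟩ := hcur rfl
  have hst : E.QueryState k t₀ r (E.proc t k) := hg.state
  have hj : j ∉ (E.proc t k).responders :=
    hg.net.notMem_of_inSlot nofun hm ⟨rfl, rfl, rfl⟩
  refine ⟨t₀, r, rfl, (hst.collected.mono ?_).insert ?_ hknown ?_ hsampled⟩
  · exact (le_max_left _ _).trans (Nat.le_succ _)
  · exact fun hj' => hj (Finset.mem_union_left _ hj')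
  · exact htime.trans ((le_max_right _ _).trans (Nat.le_succ _))

theorem QueryState.insert (h : E.QueryState k t₀ r s)
    (hcol : E.Collected (E.proc (t₀ + 1) k).lt r (max s.lt l + 1)
      (insert (toLex (τ, j)) s.responses))
    (hq : (insert (toLex (τ, j)) s.responses).card ≠ quorum n) :
    E.QueryState k t₀ r { s with
      lt := max s.lt l + 1
      responses := insert (toLex (τ, j)) s.responses } where
  rid := h.rid
  reading := h.reading
  rreg := h.rreg
  acks := h.acks
  card_lt := by
    have hle := Finset.card_insert_le (toLex (τ, j)) s.responses
    exact lt_of_le_of_ne (hle.trans h.card_lt) hq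
  collected := hcol

theorem QueryState.toUpdate {x : TSV ×ₗ Fin n} {Q : Finset (TSV ×ₗ Fin n)} {c : ℕ}
    (h : E.QueryState k t₀ r s) (hcol : E.Collected (E.proc (t₀ + 1) k).lt r c Q)
    (hq : Q.card = quorum n) (hx : x ∈ Q) (hmax : ∀ y ∈ Q, y ≤ x) :
    E.UpdateState k t₀ (.read r) (ofLex x).1 { s with
      lt := c
      rval := (ofLex (ofLex x).1).2
      responses := ∅
      rid := s.rid + 1 } where
  rid_le := (congrArg (· + 1) h.rid).le
  responses := rfl
  known := hcol.known x hx
  time_le := hcol.time_le x hx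
  card_lt := by simpa [h.acks] using quorum_pos n
  secured := by simp [h.acks]
  read _ hr := by
    cases hr
    exact ⟨h.reading, rfl, hcol.exists_quorum hq hmax⟩
  write _ _ hw := by cases hw

theorem Invariant.receive_response_of_card_ne (h : E.Invariant t)
    (hq : (insert (toLex (τ, j)) (E.proc t k).responses).card ≠ quorum n)
    (hr : E.Receives t ⟨j, k, .response l (E.proc t k).rid τ⟩ rest
      (onReceive k (E.proc t k) j (.response l (E.proc t k).rid τ))) : E.Invariant (t + 1) := by
  rw [onReceive_response_of_card_ne rfl hq] at hr
  obtain ⟨g, hg⟩ := h.client k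
  obtain ⟨t₀, r, rfl, hcol⟩ := hg.exists_query hr.mem_transit
  have hst : E.QueryState k t₀ r (E.proc t k) := hg.state
  have hle : (E.proc t k).lt ≤ max (E.proc t k).lt l + 1 := by omega
  refine h.of_clientStep hr.toHandlerStep (by simp [Packet.client, Msg.isRequest]) (by simp)
    ((h.server k).mono rfl hle)
    (hr.clientInv (g := .query t₀ r) (hr.busy_succ_iff_ne_idle rfl hg nofun nofun)
      (hg.pending.succ (hr.event_ne rfl)) (hst.insert hcol hq) ?_)
  have hnet := hg.net
  rw [hr.transit] at hnet
  simpa only [ProcState.responders, Finset.image_insert, Finset.insert_union, ofLex_toLex, add_zero]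
    using hnet.hear (j := j) nofun ⟨rfl, rfl, rfl⟩

theorem Invariant.receive_response_of_card_eq (h : E.Invariant t)
    (hq : (insert (toLex (τ, j)) (E.proc t k).responses).card = quorum n)
    (hr : E.Receives t ⟨j, k, .response l (E.proc t k).rid τ⟩ rest
      (onReceive k (E.proc t k) j (.response l (E.proc t k).rid τ))) : E.Invariant (t + 1) := by
  obtain ⟨x, hx, hmax, heq⟩ := exists_onReceive_response_of_card_eq (i := k) (l := l) rfl hq
  rw [heq] at hr
  obtain ⟨g, hg⟩ := h.client k
  obtain ⟨t₀, r, rfl, hcol⟩ := hg.exists_query hr.mem_transit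
  have hst : E.QueryState k t₀ r (E.proc t k) := hg.state
  have hupd := hst.toUpdate hcol hq hx hmax
  have hle : (E.proc t k).lt ≤ max (E.proc t k).lt l + 1 := by omega
  refine h.of_clientStep hr.toHandlerStep (by simp [Packet.client, Msg.isRequest])
    (fun m => client_of_mem_bcast rfl) ((h.server k).mono rfl hle)
    (hr.clientInv (g := .update t₀ (.read r) (ofLex x).1)
      (hr.busy_succ_iff_ne_idle rfl hg nofun nofun) (hg.pending.succ (hr.event_ne rfl)) hupd ?_)
  simp only [ProcState.responders, Finset.image_empty, Finset.empty_union, hst.acks, hst.rreg]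
  exact hg.net.broadcast rfl rfl (fun m hm => hr.transit ▸ Multiset.mem_add.2 (.inr hm))
    fun _ => ⟨le_rfl, hupd.time_le, hupd.known, fun _ => ⟨t₀, _, rfl, rfl⟩⟩

theorem Invariant.receive_response (h : E.Invariant t)
    (hr : E.Receives t ⟨j, k, .response l rid τ⟩ rest
      (onReceive k (E.proc t k) j (.response l rid τ))) : E.Invariant (t + 1) := by
  by_cases hrid : (E.proc t k).rid = rid
  · subst hrid
    by_cases hq : (insert (toLex (τ, j)) (E.proc t k).responses).card = quorum n
    · exact h.receive_response_of_card_eq hq hr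
    · exact h.receive_response_of_card_ne hq hr
  · rw [onReceive_response_of_ne hrid] at hr
    exact h.receive_stale rfl hrid hr

end Responses

section Acks

theorem ClientInv.exists_update (hg : E.ClientInv t k g)
    (hm : ⟨j, k, .ack l (E.proc t k).rid⟩ ∈ (E.config t).transit) :
    ∃ t₀ o τ, g = .update t₀ o τ ∧
      ∀ i ∈ insert j (E.proc t k).acks, E.Secured (max (E.proc t k).lt l + 1) i o.reg τ := by
  obtain ⟨-, hcur⟩ := hg.net.packets _ hm rfl
  obtain ⟨t₀, o, τ, rfl, hsecured⟩ := hcur rfl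
  have hst : E.UpdateState k t₀ o τ (E.proc t k) := hg.state
  refine ⟨t₀, o, τ, rfl, Finset.forall_mem_insert _ _ _ |>.2 ⟨?_, fun i hi => ?_⟩⟩
  · exact hsecured.mono ((le_max_right _ _).trans (Nat.le_succ _))
  · exact (hst.secured i hi).mono ((le_max_left _ _).trans (Nat.le_succ _))

theorem UpdateState.insert {c : ℕ} (h : E.UpdateState k t₀ o τ s) (hc : s.lt ≤ c)
    (hsecured : ∀ i ∈ insert j s.acks, E.Secured c i o.reg τ)
    (hq : (insert j s.acks).card ≠ quorum n) :
    E.UpdateState k t₀ o τ { s with lt := c, acks := insert j s.acks } where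
  rid_le := h.rid_le
  responses := h.responses
  known := h.known
  time_le := h.time_le.trans hc
  card_lt := by
    have hle := Finset.card_insert_le j s.acks
    exact lt_of_le_of_ne (hle.trans h.card_lt) hq
  secured := hsecured
  read := h.read
  write := h.write

theorem Invariant.receive_ack_of_card_ne (h : E.Invariant t)
    (hq : (insert j (E.proc t k).acks).card ≠ quorum n)
    (hr : E.Receives t ⟨j, k, .ack l (E.proc t k).rid⟩ rest
      (onReceive k (E.proc t k) j (.ack l (E.proc t k).rid))) : E.Invariant (t + 1) := by
  rw [onReceive_ack_of_card_ne rfl hq] at hr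
  obtain ⟨g, hg⟩ := h.client k
  obtain ⟨t₀, o, τ, rfl, hsecured⟩ := hg.exists_update hr.mem_transit
  have hst : E.UpdateState k t₀ o τ (E.proc t k) := hg.state
  have hle : (E.proc t k).lt ≤ max (E.proc t k).lt l + 1 := by omega
  refine h.of_clientStep hr.toHandlerStep (by simp [Packet.client, Msg.isRequest]) (by simp)
    ((h.server k).mono rfl hle)
    (hr.clientInv (g := .update t₀ o τ) (hr.busy_succ_iff_ne_idle rfl hg nofun nofun)
      (hg.pending.succ (hr.event_ne rfl)) (hst.insert hle hsecured hq) ?_)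
  have hnet := hg.net
  rw [hr.transit] at hnet
  simpa only [ProcState.responders, Finset.union_insert, add_zero]
    using hnet.hear (j := j) nofun ⟨rfl, rfl, rfl⟩

theorem Invariant.receive_ack_of_card_eq (h : E.Invariant t)
    (hq : (insert j (E.proc t k).acks).card = quorum n)
    (hr : E.Receives t ⟨j, k, .ack l (E.proc t k).rid⟩ rest
      (onReceive k (E.proc t k) j (.ack l (E.proc t k).rid))) : E.Invariant (t + 1) := by
  rw [onReceive_ack_of_card_eq rfl hq] at hr
  obtain ⟨g, hg⟩ := h.client k
  obtain ⟨t₀, o, τ, rfl, -⟩ := hg.exists_update hr.mem_transit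
  have hst : E.UpdateState k t₀ o τ (E.proc t k) := hg.state
  have hle : (E.proc t k).lt ≤ max (E.proc t k).lt l + 1 := by omega
  refine h.of_clientStep (g := .idle) hr.toHandlerStep (by simp [Packet.client, Msg.isRequest])
    (by simp) ((h.server k).mono rfl hle)
    (hr.clientInv (by simp [hr.busy_succ]) trivial ⟨hst.responses, rfl⟩ ?_)
  exact hg.net.finish _ fun m hm => hr.transit ▸ Multiset.mem_add.2 (.inr (by simpa using hm))

theorem Invariant.receive_ack (h : E.Invariant t)
    (hr : E.Receives t ⟨j, k, .ack l rid⟩ rest (onReceive k (E.proc t k) j (.ack l rid))) :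
    E.Invariant (t + 1) := by
  by_cases hrid : (E.proc t k).rid = rid
  · subst hrid
    by_cases hq : (insert j (E.proc t k).acks).card = quorum n
    · exact h.receive_ack_of_card_eq hq hr
    · exact h.receive_ack_of_card_ne hq hr
  · rw [onReceive_ack_of_ne hrid] at hr
    exact h.receive_stale rfl hrid hr

end Acks

theorem invariant (E : Execution X n) : ∀ t, E.Invariant t
  | 0 => E.invariant_zero
  | t + 1 => by
    have h := E.invariant t
    rcases E.step_cases t with hst | ⟨k, o, hk⟩ | ⟨⟨j, k, M⟩, rest, hr⟩
    · exact h.of_stutters hst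
    · exact h.invoke hk
    · cases M with
      | query => exact h.receive_query hr
      | response => exact h.receive_response hr
      | update => exact h.receive_update hr
      | ack => exact h.receive_ack hr

end Execution

end ClientSteps

/-! ### Operation records and termination -/

section OperationRecords

variable {X : Type*} {n : ℕ}

namespace Execution

/-- What holds of an operation `o` that is invoked by `i` at time `t₀` and returns `a` at time `t`:
`τ` is the pair that it has written to a quorum, and, for a read, the pair that it has read from a
quorum. -/
structure OpRecord (E : Execution X n) (t₀ t : ℕ) (i : Fin n) (o : Op X) (a : Ret) (τ : TSV) :
    Prop where
  known : E.Known o.reg τ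
  time_le : tsvTime τ ≤ (E.proc (t + 1) i).lt
  secured : ∃ Q : Finset (Fin n), Q.card = quorum n ∧
    ∀ j ∈ Q, E.Secured (E.proc (t + 1) i).lt j o.reg τ
  read : ∀ r, o = .read r → a = .value (ofLex τ).2 ∧
    ∃ Q : Finset (Fin n), Q.card = quorum n ∧ ∀ j ∈ Q, E.Sampled (E.proc (t₀ + 1) i).lt j r τ
  write : ∀ r v, o = .write r v → τ = writeTSV (E.proc (t₀ + 1) i).lt i v

variable {E : Execution X n} {t t₀ : ℕ} {i : Fin n} {o : Op X} {a : Ret} {τ : TSV}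

theorem UpdateState.accepts {s : ProcState X n} (h : E.UpdateState i t₀ o τ s) :
    o.Accepts (if s.reading then .value s.rval else .ok) := by
  cases o with
  | read r => simp [(h.read r rfl).1, Op.Accepts]
  | write r v => simp [(h.write r v rfl).1, Op.Accepts]

theorem exists_opRecord (h : E.event t = some (.res i a)) :
    ∃ t₀ o τ, E.Pending t₀ i o t ∧ o.Accepts a ∧ E.OpRecord t₀ t i o a τ := by
  rcases E.step_cases t with hst | ⟨k, o, hk⟩ | ⟨⟨j, k, M⟩, rest, hr⟩
  · exact nomatch hst.event.symm.trans h
  · exact nomatch hk.event.symm.trans h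
  obtain ⟨b, hret, hev⟩ := Option.map_eq_some_iff.1 (hr.event.symm.trans h)
  obtain ⟨rfl, rfl⟩ : k = i ∧ b = a := by simpa using hev
  obtain ⟨l, hM, hq⟩ := onReceive_ret_eq_some hret
  dsimp only at hM hq
  subst hM
  rw [onReceive_ack_of_card_eq rfl hq] at hr hret
  obtain rfl := Option.some.inj hret
  obtain ⟨g, hg⟩ := (E.invariant t).client k
  obtain ⟨t₀, o, τ, rfl, hsecured⟩ := hg.exists_update hr.mem_transit
  have hst : E.UpdateState k t₀ o τ (E.proc t k) := hg.state
  have hlt : (E.proc (t + 1) k).lt = max (E.proc t k).lt l + 1 := by rw [hr.proc_succ]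
  refine ⟨t₀, o, τ, hg.pending, hst.accepts, hst.known, ?_, ⟨_, hq, ?_⟩, ?_,
    fun r v ho => (hst.write r v ho).2⟩
  · exact hst.time_le.trans (E.clock_monotone k t.le_succ)
  · rwa [hlt]
  · intro r ho
    obtain ⟨hreading, hval, hQ⟩ := hst.read r ho
    exact ⟨by rw [hreading, hval, if_pos rfl], hQ⟩

theorem Invokes.eq_of_event {k : Fin n} {o' : Op X} {e : Effect X n} (h : E.Invokes t k o' e)
    (hev : E.event t = some (.inv i o)) : k = i := by
  have := h.event.symm.trans hev
  rw [Option.some.injEq, Event.inv.injEq] at this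
  exact this.1

theorem mem_busy_succ_of_inv (h : E.event t = some (.inv i o)) :
    i ∈ (E.config (t + 1)).busy := by
  rcases E.step_cases t with hst | ⟨k, o', hk⟩ | ⟨m, rest, hr⟩
  · exact nomatch hst.event.symm.trans h
  · exact hk.eq_of_event h ▸ hk.busy_succ
  · obtain ⟨_, -, hev⟩ := Option.map_eq_some_iff.1 (hr.event.symm.trans h)
    cases hev

theorem busy_succ_of_forall_ne (hb : i ∈ (E.config t).busy)
    (hres : ∀ a, E.event t ≠ some (.res i a)) :
    i ∈ (E.config (t + 1)).busy ∧ ∀ e, E.event t = some e → e.proc ≠ i := by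
  rcases E.step_cases t with hst | ⟨k, o', hk⟩ | ⟨m, rest, hr⟩
  · exact ⟨hst.busy_succ ▸ hb, by simp [hst.event]⟩
  · have hne : i ≠ k := by
      rintro rfl
      exact hk.not_busy hb
    exact ⟨(hk.busy_succ_of_ne i hne).2 hb, fun e he => hk.event_proc e he ▸ hne.symm⟩
  · rcases eq_or_ne i m.dst with rfl | hne
    · have hret : (onReceive m.dst (E.proc t m.dst) m.src m.msg).ret = none := by
        rw [Option.eq_none_iff_forall_ne_some]
        intro a ha
        exact hres a (by rw [hr.event, ha, Option.map_some])
      exact ⟨hr.busy_succ.2 ⟨hret, hb⟩, by simp [hr.event_eq_none hret]⟩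
    · exact ⟨(hr.busy_succ_of_ne i hne).2 hb, fun e he => hr.event_proc e he ▸ hne.symm⟩

theorem busy_and_pending (h : E.event t₀ = some (.inv i o)) (ht : t₀ < t)
    (hres : ∀ u a, t₀ < u → u < t → E.event u ≠ some (.res i a)) :
    i ∈ (E.config t).busy ∧ E.Pending t₀ i o t := by
  induction t, ht using Nat.le_induction with
  | base => exact ⟨mem_busy_succ_of_inv h, pending_succ_self h⟩
  | succ t ht ih =>
    obtain ⟨hb, hpend⟩ := ih fun u a hu hu' => hres u a hu (hu'.trans t.lt_succ_self)
    obtain ⟨hb', hne⟩ := busy_succ_of_forall_ne hb fun a => hres t a ht t.lt_succ_self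
    exact ⟨hb', hpend.succ hne⟩

theorem completesBetween_of_response (h : E.event t₀ = some (.inv i o)) (ht : t₀ < t)
    (hr : E.event t = some (.res i a)) : ∃ u b, CompletesBetween E.event t₀ u i o b := by
  classical
  have hex : ∃ u, t₀ < u ∧ ∃ b, E.event u = some (.res i b) := ⟨t, ht, a, hr⟩
  obtain ⟨hu, b, hb⟩ := Nat.find_spec hex
  obtain ⟨-, hpend⟩ := busy_and_pending h hu fun v c hv hv' hc => Nat.find_min hex hv' ⟨hv, c, hc⟩
  obtain ⟨t₁, o₁, τ, hpend', haccepts, -⟩ := exists_opRecord hb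
  obtain ⟨rfl, rfl⟩ := hpend.unique hpend'
  exact ⟨_, b, hu, h, hb, haccepts, hpend.proc_ne⟩

end Execution

end OperationRecords

section Termination

variable {X : Type*} {n : ℕ}

section Handlers

variable {i j : Fin n} {s : ProcState X n} {M : Msg X}

theorem responders_subset_onReceive (h : (onReceive i s j M).state.rid = s.rid) :
    s.responders ⊆ (onReceive i s j M).state.responders := by
  cases M with
  | query | update => exact subset_rfl
  | response l rid τ =>
    by_cases hrid : s.rid = rid
    · by_cases hq : (insert (toLex (τ, j)) s.responses).card = quorum n
      · obtain ⟨x, -, -, heq⟩ := exists_onReceive_response_of_card_eq (i := i) (l := l) hrid hq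
        rw [heq] at h
        exact absurd h (Nat.succ_ne_self _)
      · rw [onReceive_response_of_card_ne hrid hq]
        exact Finset.union_subset_union_left
          (Finset.image_subset_image (Finset.subset_insert _ _))
    · rw [onReceive_response_of_ne hrid]
  | ack l rid =>
    by_cases hrid : s.rid = rid
    · by_cases hq : (insert j s.acks).card = quorum n
      · rw [onReceive_ack_of_card_eq hrid hq] at h
        exact absurd h (Nat.succ_ne_self _)
      · rw [onReceive_ack_of_card_ne hrid hq]
        exact Finset.union_subset_union_right (Finset.subset_insert _ _)
    · rw [onReceive_ack_of_ne hrid]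

theorem mem_responders_onReceive (hM : M.isRequest = false) (hrid : s.rid = M.rid)
    (h : (onReceive i s j M).state.rid = s.rid) : j ∈ (onReceive i s j M).state.responders := by
  cases M with
  | query | update => cases hM
  | response l rid τ =>
    replace hrid : s.rid = rid := hrid
    by_cases hq : (insert (toLex (τ, j)) s.responses).card = quorum n
    · obtain ⟨x, -, -, heq⟩ := exists_onReceive_response_of_card_eq (i := i) (l := l) hrid hq
      rw [heq] at h
      exact absurd h (Nat.succ_ne_self _)
    · rw [onReceive_response_of_card_ne hrid hq]
      simp [ProcState.responders]
  | ack l rid =>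
    replace hrid : s.rid = rid := hrid
    by_cases hq : (insert j s.acks).card = quorum n
    · rw [onReceive_ack_of_card_eq hrid hq] at h
      exact absurd h (Nat.succ_ne_self _)
    · rw [onReceive_ack_of_card_ne hrid hq]
      simp [ProcState.responders]

theorem exists_answer (hM : M.isRequest = true) :
    ∃ M' : Msg X, M'.isRequest = false ∧ M'.rid = M.rid ∧
      ⟨i, j, M'⟩ ∈ (onReceive i s j M).sends := by
  cases M with
  | query l rid r => exact ⟨.response _ rid _, rfl, rfl, Multiset.mem_singleton_self _⟩
  | update l rid r τ => exact ⟨.ack _ rid, rfl, rfl, Multiset.mem_singleton_self _⟩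
  | response | ack => cases hM

end Handlers

theorem exists_forall_ge_eq_of_bounded {α : Type*} [Preorder α] {f : α → ℕ} (hf : Monotone f)
    {B : ℕ} {a : α} (hB : ∀ b, a ≤ b → f b ≤ B) : ∃ c, a ≤ c ∧ ∀ b, c ≤ b → f b = f c := by
  have hbdd : BddAbove (f '' Set.Ici a) := ⟨B, Set.forall_mem_image.2 hB⟩
  obtain ⟨c, hac, hc⟩ := Nat.sSup_mem (Set.nonempty_Ici.image f) hbdd
  exact ⟨c, hac, fun b hcb =>
    (hc ▸ le_csSup hbdd ⟨b, hac.trans hcb, rfl⟩ : f b ≤ f c).antisymm (hf hcb)⟩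

namespace Execution

variable {E : Execution X n} {t t₀ T : ℕ} {i j : Fin n} {o : Op X} {M : Msg X}

theorem responders_subset_succ (h : (E.proc (t + 1) i).rid = (E.proc t i).rid) :
    (E.proc t i).responders ⊆ (E.proc (t + 1) i).responders := by
  rcases E.proc_succ_cases t i with heq | ⟨o, heq⟩ | ⟨j, M, heq⟩ <;> rw [heq] at h ⊢
  · rw [rid_onInvoke] at h
    exact absurd h (Nat.succ_ne_self _)
  · exact responders_subset_onReceive h

theorem responders_mono (hrid : ∀ u, T ≤ u → (E.proc u i).rid = (E.proc T i).rid) {u v : ℕ}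
    (hu : T ≤ u) (huv : u ≤ v) : (E.proc u i).responders ⊆ (E.proc v i).responders := by
  induction v, huv using Nat.le_induction with
  | base => exact subset_rfl
  | succ v hv ih =>
    have hv' := hrid v (hu.trans hv)
    exact ih.trans (responders_subset_succ
      ((hrid (v + 1) (hu.trans (hv.trans v.le_succ))).trans hv'.symm))

theorem card_responders_lt (E : Execution X n) (t : ℕ) (i : Fin n) :
    (E.proc t i).responders.card < quorum n := by
  obtain ⟨g, hg⟩ := (E.invariant t).client i
  have hstate := hg.state
  cases g with
  | idle =>
    rw [ProcState.responders, hstate.1, hstate.2]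
    exact quorum_pos n
  | query t₀ r =>
    have hst : E.QueryState i t₀ r (E.proc t i) := hstate
    rw [ProcState.responders, hst.acks, Finset.union_empty]
    exact Finset.card_image_le.trans_lt hst.card_lt
  | update t₀ o τ =>
    have hst : E.UpdateState i t₀ o τ (E.proc t i) := hstate
    rw [ProcState.responders, hst.responses, Finset.image_empty, Finset.empty_union]
    exact hst.card_lt

theorem rid_le_of_pending (hb : i ∈ (E.config t).busy) (hpend : E.Pending t₀ i o t) :
    (E.proc t i).rid ≤ (E.proc (t₀ + 1) i).rid + 1 := by
  obtain ⟨g, hg⟩ := (E.invariant t).client i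
  cases g with
  | idle => exact absurd rfl (hg.busy.1 hb)
  | query t₁ r =>
    have hst : E.QueryState i t₁ r (E.proc t i) := hg.state
    obtain ⟨rfl, -⟩ := hpend.unique hg.pending
    exact hst.rid.trans_le (Nat.le_succ _)
  | update t₁ o' τ =>
    have hst : E.UpdateState i t₁ o' τ (E.proc t i) := hg.state
    obtain ⟨rfl, -⟩ := hpend.unique hg.pending
    exact hst.rid_le

theorem exists_mem_responders_of_answer (hE : E.EventualDelivery) (hi : i ∉ E.faulty)
    (hj : j ∉ E.faulty) (hrid : ∀ u, T ≤ u → (E.proc u i).rid = (E.proc T i).rid) (ht : T ≤ t)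
    (hM : M.isRequest = false) (hMrid : M.rid = (E.proc T i).rid)
    (hmem : ⟨j, i, M⟩ ∈ (E.config t).transit) :
    ∃ u, T ≤ u ∧ j ∈ (E.proc u i).responders := by
  obtain ⟨u, hu, hstep⟩ := hE t _ hmem hj hi
  obtain ⟨rest, hr⟩ := E.exists_receives hstep
  have hTu := ht.trans hu
  have hu0 := hrid u hTu
  have hu1 := hrid (u + 1) (hTu.trans u.le_succ)
  rw [← hu0, hr.proc_succ] at hu1
  refine ⟨u + 1, hTu.trans u.le_succ, ?_⟩
  rw [hr.proc_succ]
  exact mem_responders_onReceive hM (hu0.trans hMrid.symm) hu1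

theorem exists_mem_responders (hE : E.EventualDelivery) (hi : i ∉ E.faulty) (hj : j ∉ E.faulty)
    (hb : i ∈ (E.config T).busy) (hrid : ∀ u, T ≤ u → (E.proc u i).rid = (E.proc T i).rid) :
    ∃ u, T ≤ u ∧ j ∈ (E.proc u i).responders := by
  obtain ⟨g, hg⟩ := (E.invariant T).client i
  have hslots := hg.net.slots (hg.busy.1 hb) j
  split_ifs at hslots with hresp
  · exact ⟨T, le_rfl, hresp⟩
  obtain ⟨⟨a, b, M⟩, hm, hclient, hserver, hMrid⟩ := slotCount_pos.1 (by omega :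
    0 < slotCount i j (E.proc T i).rid (E.config T).transit)
  rcases hM : M.isRequest
  · obtain ⟨rfl, rfl⟩ : b = i ∧ a = j := by
      simpa [Packet.client, Packet.server, hM] using And.intro hclient hserver
    exact exists_mem_responders_of_answer hE hi hj hrid le_rfl hM hMrid hm
  · obtain ⟨rfl, rfl⟩ : a = i ∧ b = j := by
      simpa [Packet.client, Packet.server, hM] using And.intro hclient hserver
    obtain ⟨u, hu, hstep⟩ := hE T _ hm hi hj
    obtain ⟨rest, hr⟩ := E.exists_receives hstep
    obtain ⟨M', hM', hrid', hmem⟩ := exists_answer (i := b) (j := a) (s := E.proc u b) hM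
    refine exists_mem_responders_of_answer (t := u + 1) hE hi hj hrid (hu.trans u.le_succ) hM'
      (hrid'.trans hMrid) ?_
    rw [hr.transit_succ]
    exact Multiset.mem_add.2 (.inr hmem)

theorem exists_compl_faulty_subset_responders (hE : E.EventualDelivery) (hi : i ∉ E.faulty)
    (hb : i ∈ (E.config T).busy) (hrid : ∀ u, T ≤ u → (E.proc u i).rid = (E.proc T i).rid) :
    ∃ U, E.faultyᶜ ⊆ ((E.proc U i).responders : Set (Fin n)) := by
  have hresp : ∀ j, ∃ u, j ∉ E.faulty → T ≤ u ∧ j ∈ (E.proc u i).responders := fun j => by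
    by_cases hj : j ∈ E.faulty
    · exact ⟨T, absurd hj⟩
    · exact (exists_mem_responders hE hi hj hb hrid).imp fun _ hu _ => hu
  choose u hu using hresp
  exact ⟨Finset.univ.sup u, fun j hj =>
    responders_mono hrid (hu j hj).1 (Finset.le_sup (Finset.mem_univ j)) (hu j hj).2⟩

theorem exists_response (hfaulty : 2 * E.faulty.ncard < n) (hE : E.EventualDelivery)
    (hi : i ∉ E.faulty) (h : E.event t₀ = some (.inv i o)) :
    ∃ t a, t₀ < t ∧ E.event t = some (.res i a) := by
  by_contra! hcon
  have hbp : ∀ t, t₀ < t → i ∈ (E.config t).busy ∧ E.Pending t₀ i o t := fun t ht =>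
    busy_and_pending h ht fun u a hu _ => hcon u a hu
  obtain ⟨T, hT, hrid⟩ := exists_forall_ge_eq_of_bounded (E.rid_monotone i) (a := t₀ + 1)
    fun u hu => rid_le_of_pending (hbp u hu).1 (hbp u hu).2
  obtain ⟨U, hU⟩ := exists_compl_faulty_subset_responders hE hi (hbp T hT).1 hrid
  have hle := Set.ncard_le_ncard hU (Finset.finite_toSet _)
  rw [Set.ncard_coe_finset] at hle
  have hcompl := Set.ncard_add_ncard_compl E.faulty
  rw [Nat.card_fin] at hcompl
  have hlt := E.card_responders_lt U i
  unfold quorum at hlt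
  omega

theorem terminates (hfaulty : 2 * E.faulty.ncard < n) (hE : E.EventualDelivery) :
    E.Terminates := by
  intro k i o hk hi
  obtain ⟨t₀, h, rfl⟩ := compact_get?_eq_some.1 hk
  obtain ⟨t, a, ht, hr⟩ := exists_response hfaulty hE hi h
  exact (completesAt_compactIndex_iff h).2 (completesBetween_of_response h ht hr)

end Execution

end Termination

/-! ### Merging the orders on the registers -/

section Merge

variable {O X β κ : Type*} {reg : O → X} {rk : O → β} {start : O → κ} {x y : O} {m : κ}

section Preorder

variable [Preorder β]

/-- The starting points of the elements of the chain of `x` up to `x`, where the elements of `O` are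
partitioned into chains by `reg`, and each chain is ordered by `rk`. -/
def startsBelow (reg : O → X) (rk : O → β) (start : O → κ) (x : O) : Set κ :=
  start '' {y | reg y = reg x ∧ rk y ≤ rk x}

theorem start_mem_startsBelow : start x ∈ startsBelow reg rk start x := ⟨x, ⟨rfl, le_rfl⟩, rfl⟩

theorem startsBelow_subset (hreg : reg x = reg y) (h : rk x ≤ rk y) :
    startsBelow reg rk start x ⊆ startsBelow reg rk start y :=
  Set.image_mono fun _ hz => ⟨hz.1.trans hreg, hz.2.trans h⟩

end Preorder

variable [LinearOrder β] [ConditionallyCompleteLinearOrder κ]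

/-- The key by which the chains are merged into one order: the latest starting point in the chain
of `x` up to `x`, with ties broken by `rk`. -/
noncomputable def mergeKey (reg : O → X) (rk : O → β) (start : O → κ) (x : O) : κ ×ₗ β :=
  toLex (sSup (startsBelow reg rk start x), rk x)

theorem mergeKey_injective (hrk : Function.Injective rk) :
    Function.Injective (mergeKey reg rk start) := fun _ _ h =>
  hrk (congrArg (fun z => (ofLex z).2) h)

theorem mergeKey_lt_mergeKey (hbdd : ∀ z, BddAbove (startsBelow reg rk start z))
    (hreg : reg x = reg y) (h : rk x < rk y) : mergeKey reg rk start x < mergeKey reg rk start y :=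
  Prod.Lex.toLex_lt_toLex.2 <|
    (csSup_le_csSup (hbdd y) ⟨_, start_mem_startsBelow⟩
      (startsBelow_subset hreg h.le)).lt_or_eq.imp_right fun heq => ⟨heq, h⟩

theorem mergeKey_lt_mergeKey_iff (hbdd : ∀ z, BddAbove (startsBelow reg rk start z))
    (hrk : Function.Injective rk) (hreg : reg x = reg y) :
    mergeKey reg rk start x < mergeKey reg rk start y ↔ rk x < rk y := by
  refine ⟨fun h => lt_of_not_ge fun hle => ?_, mergeKey_lt_mergeKey hbdd hreg⟩
  rcases hle.lt_or_eq with hlt | heq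
  · exact (mergeKey_lt_mergeKey hbdd hreg.symm hlt).not_gt h
  · exact h.ne (congrArg _ (hrk heq).symm)

theorem mergeKey_lt_mergeKey_of_forall_le (hbdd : BddAbove (startsBelow reg rk start y))
    (hx : ∀ z, reg z = reg x → rk z ≤ rk x → start z ≤ m) (hm : m < start y) :
    mergeKey reg rk start x < mergeKey reg rk start y := by
  have hle : sSup (startsBelow reg rk start x) ≤ m :=
    csSup_le ⟨_, start_mem_startsBelow⟩ (Set.forall_mem_image.2 fun z hz => hx z hz.1 hz.2)
  exact Prod.Lex.toLex_lt_toLex.2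
    (.inl (hle.trans_lt (hm.trans_le (le_csSup hbdd start_mem_startsBelow))))

theorem finite_setOf_mergeKey_le (hbdd : ∀ z, BddAbove (startsBelow reg rk start z))
    (hstart : ∀ m, {z | start z ≤ m}.Finite) (x : O) :
    {y | mergeKey reg rk start y ≤ mergeKey reg rk start x}.Finite :=
  (hstart (sSup (startsBelow reg rk start x))).subset fun y hy =>
    (le_csSup (hbdd y) start_mem_startsBelow).trans (Prod.Lex.monotone_fst _ _ hy)

end Merge

section Linearization

variable {X : Type*} {n : ℕ}

section Quorums

variable {Q Q' : Finset (Fin n)}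

theorem lt_of_tsvTime_lt {σ τ : TSV} (h : tsvTime σ < tsvTime τ) : σ < τ :=
  Prod.Lex.lt_iff.2 (.inl (Prod.Lex.lt_iff.2 (.inl h)))

theorem exists_mem_inter_of_card_eq_quorum (h : Q.card = quorum n) (h' : Q'.card = quorum n) :
    ∃ j, j ∈ Q ∩ Q' := by
  refine Finset.inter_nonempty_of_card_lt_card_add_card (Finset.subset_univ Q)
    (Finset.subset_univ Q') ?_
  rw [h, h', Finset.card_univ, Fintype.card_fin, quorum]
  omega

end Quorums

/-- The operation is a read. -/
def Op.isRead : Op X → Bool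
  | .read _ => true
  | .write _ _ => false

theorem OperationFamily.exists_invTime_eq {s : ℕ → Option (Event X n)} {O : Type*}
    (F : OperationFamily s O) {t : ℕ} {i : Fin n} {o : Op X} (h : s t = some (.inv i o)) :
    ∃ x, F.invTime x = t ∧ F.proc x = i ∧ F.op x = o := by
  obtain ⟨x, rfl | rfl⟩ := F.exhaustive t _ h
  · have hinv := (F.completes x).inv.symm.trans h
    rw [Option.some.injEq, Event.inv.injEq] at hinv
    exact ⟨x, rfl, hinv⟩
  · cases (F.completes x).res.symm.trans h

namespace Execution

variable {E : Execution X n} {t : ℕ} {i : Fin n} {o : Op X}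

theorem clock_lt_clock_succ_of_inv (h : E.event t = some (.inv i o)) :
    (E.proc t i).lt < (E.proc (t + 1) i).lt := by
  rcases E.step_cases t with hst | ⟨k, o', hk⟩ | ⟨m, rest, hr⟩
  · exact nomatch hst.event.symm.trans h
  · obtain rfl := hk.eq_of_event h
    rw [hk.proc_succ]
    exact lt_lt_onInvoke _ _ _
  · obtain ⟨_, -, hev⟩ := Option.map_eq_some_iff.1 (hr.event.symm.trans h)
    cases hev

theorem le_of_secured_of_sampled {Q Q' : Finset (Fin n)} (h : Q.card = quorum n)
    (h' : Q'.card = quorum n) {l l' : ℕ} (hl : l < l') {r : X} {σ τ : TSV}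
    (hσ : ∀ j ∈ Q, E.Secured l j r σ) (hτ : ∀ j ∈ Q', E.Sampled l' j r τ) : σ ≤ τ := by
  obtain ⟨j, hj⟩ := exists_mem_inter_of_card_eq_quorum h h'
  obtain ⟨u, hu, hσu⟩ := hσ j (Finset.mem_inter.1 hj).1
  obtain ⟨v, hv, hτv⟩ := hτ j (Finset.mem_inter.1 hj).2
  have huv : u < v := (E.clock_monotone j).reflect_lt (hu.trans_lt (hl.trans hv))
  exact hσu.trans ((E.tvps_monotone j r huv.le).trans hτv)

/-- The operations of an execution in which every operation completes, each with the
timestamp-value pair that it wrote to a quorum. -/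
structure TaggedOperations (E : Execution X n) (O : Type*) extends OperationFamily E.event O where
  tag : O → TSV
  record : ∀ x, E.OpRecord (invTime x) (resTime x) (proc x) (op x) (ret x) (tag x)

theorem exists_completesBetween_opRecord (hE : E.history.Complete)
    (h : E.event t = some (.inv i o)) :
    ∃ u a τ, CompletesBetween E.event t u i o a ∧ E.OpRecord t u i o a τ := by
  obtain ⟨u, a, hC⟩ :=
    (completesAt_compactIndex_iff h).1 (hE _ _ _ (compact_get?_compactIndex h))
  obtain ⟨t₀, o', τ, hpend, -, hR⟩ := exists_opRecord hC.res
  obtain ⟨rfl, rfl⟩ := hpend.unique (⟨hC.lt, h, hC.proc_ne⟩ : E.Pending t i o u)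
  exact ⟨u, a, τ, hC, hR⟩

theorem exists_taggedOperations (hE : E.history.Complete) :
    Nonempty (E.TaggedOperations {t // ∃ i o, E.event t = some (.inv i o)}) := by
  have hex : ∀ x : {t // ∃ i o, E.event t = some (.inv i o)}, ∃ i o u a τ,
      CompletesBetween E.event x.1 u i o a ∧ E.OpRecord x.1 u i o a τ := by
    rintro ⟨t, i, o, h⟩
    exact ⟨i, o, exists_completesBetween_opRecord hE h⟩
  choose proc op resTime ret tag hC hR using hex
  refine ⟨⟨⟨proc, op, ret, Subtype.val, resTime, hC, fun t e he => ?_, Subtype.val_injective⟩,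
    tag, hR⟩⟩
  cases e with
  | inv i o => exact ⟨⟨t, i, o, he⟩, .inl rfl⟩
  | res i a =>
    obtain ⟨t₀, o, -, hpend, -⟩ := exists_opRecord he
    have hx := hC ⟨t₀, i, o, hpend.inv⟩
    have hproc : proc ⟨t₀, i, o, hpend.inv⟩ = i := by
      have hinv := hx.inv.symm.trans hpend.inv
      rw [Option.some.injEq, Event.inv.injEq] at hinv
      exact hinv.1
    refine ⟨⟨t₀, i, o, hpend.inv⟩, .inr (le_antisymm ?_ ?_)⟩
    · exact not_lt.1 fun hlt => hpend.proc_ne _ _ hx.lt hlt hx.res hproc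
    · exact not_lt.1 fun hlt => hx.proc_ne _ _ hpend.lt hlt he hproc.symm

namespace TaggedOperations

variable {O : Type*} (F : E.TaggedOperations O) {x y : O} {r : X} {v w : ℤ}

/-- The logical time of an operation right after its invocation. -/
def startClock (x : O) : ℕ := (E.proc (F.invTime x + 1) (F.proc x)).lt

/-- The logical time of an operation right after its response. -/
def endClock (x : O) : ℕ := (E.proc (F.resTime x + 1) (F.proc x)).lt

/-- The rank by which the operations on each register are ordered: by their tags, with the write
of a tag before the reads that return it, and these by their logical times. -/
def registerRank (x : O) : TSV ×ₗ (Bool ×ₗ (ℕ ×ₗ Fin n)) :=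
  toLex (F.tag x, toLex ((F.op x).isRead, toLex (F.startClock x, F.proc x)))

variable {F}

theorem startClock_le_endClock (x : O) : F.startClock x ≤ F.endClock x :=
  E.clock_monotone _ (Nat.succ_le_succ (F.completes x).lt.le)

theorem endClock_lt_startClock (hproc : F.proc x = F.proc y) (h : F.invTime x < F.invTime y) :
    F.endClock x < F.startClock y := by
  have hinv := (F.completes y).inv
  rw [← hproc] at hinv
  rw [startClock, ← hproc]
  exact (E.clock_monotone _ ((F.completes x).res_lt_inv hinv h)).trans_lt
    (clock_lt_clock_succ_of_inv hinv)

theorem startClock_proc_injective : Function.Injective fun x => (F.startClock x, F.proc x) := by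
  intro x y h
  obtain ⟨hstart, hproc⟩ := Prod.mk.inj h
  rcases lt_trichotomy (F.invTime x) (F.invTime y) with hlt | heq | hlt
  · exact absurd hstart ((startClock_le_endClock x).trans_lt (endClock_lt_startClock hproc hlt)).ne
  · exact F.injective heq
  · exact absurd hstart
      ((startClock_le_endClock y).trans_lt (endClock_lt_startClock hproc.symm hlt)).ne'

theorem finite_setOf_startClock_le (m : ℕ) : {x | F.startClock x ≤ m}.Finite :=
  (((Set.finite_Iic m).prod Set.finite_univ).preimage startClock_proc_injective.injOn).subset
    fun _ hx => ⟨hx, Set.mem_univ _⟩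

theorem registerRank_injective : Function.Injective F.registerRank := fun _ _ h =>
  startClock_proc_injective (congrArg (fun z => ofLex (ofLex (ofLex z).2).2) h)

theorem tag_le_of_registerRank_lt (h : F.registerRank x < F.registerRank y) :
    F.tag x ≤ F.tag y :=
  Prod.Lex.monotone_fst _ _ h.le

theorem tag_eq_of_write (hx : F.op x = .write r v) :
    F.tag x = writeTSV (F.startClock x) (F.proc x) v :=
  (F.record x).write r v hx

theorem eq_of_tag_eq {r' : X} (hx : F.op x = .write r v) (hy : F.op y = .write r' w)
    (h : F.tag x = F.tag y) : x = y := by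
  rw [tag_eq_of_write hx, tag_eq_of_write hy, writeTSV, writeTSV] at h
  obtain ⟨hstart, hpid⟩ := Prod.mk.inj (Prod.mk.inj h).1
  exact startClock_proc_injective (Prod.ext hstart (Fin.ext (Nat.succ_injective hpid)))

theorem initTSV_lt_tag (hx : F.op x = .write r v) : initTSV < F.tag x := by
  refine lt_of_tsvTime_lt ?_
  rw [tag_eq_of_write hx]
  exact (Nat.zero_le _).trans_lt (clock_lt_clock_succ_of_inv (F.completes x).inv)

theorem eq_value_of_read (hx : F.op x = .read r) (hv : F.ret x = .value v) :
    v = (ofLex (F.tag x)).2 :=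
  Ret.value.inj (hv.symm.trans ((F.record x).read r hx).1)

theorem tag_eq_init_or_exists_write (x : O) :
    F.tag x = initTSV ∨ ∃ y v, F.op y = .write (F.op x).reg v ∧ F.tag y = F.tag x := by
  refine (F.record x).known.imp_right ?_
  rintro ⟨t, i, v, h, htag⟩
  obtain ⟨y, rfl, rfl, hop⟩ := F.exists_invTime_eq h
  exact ⟨y, v, hop, (tag_eq_of_write hop).trans htag.symm⟩

theorem registerRank_lt_of_tag_eq (hx : F.op x = .write r v) (hy : F.op y = .read r)
    (h : F.tag x = F.tag y) : F.registerRank x < F.registerRank y := by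
  rw [registerRank, registerRank, hx, hy]
  exact Prod.Lex.toLex_lt_toLex.2
    (.inr ⟨h, Prod.Lex.toLex_lt_toLex.2 (.inl Bool.false_lt_true)⟩)

theorem registerRank_lt_of_endClock_lt (hreg : (F.op x).reg = (F.op y).reg)
    (h : F.endClock x < F.startClock y) : F.registerRank x < F.registerRank y := by
  rw [registerRank, registerRank]
  cases hy : F.op y with
  | write r w =>
    refine Prod.Lex.toLex_lt_toLex.2 (.inl (lt_of_tsvTime_lt ?_))
    rw [tag_eq_of_write hy]
    exact (F.record x).time_le.trans_lt h
  | read r =>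
    obtain ⟨-, Q', hQ', hsampled⟩ := (F.record y).read r hy
    obtain ⟨Q, hQ, hsecured⟩ := (F.record x).secured
    rw [hreg, hy] at hsecured
    have hstart : F.startClock x < F.startClock y := (startClock_le_endClock x).trans_lt h
    have htag : F.tag x ≤ F.tag y := le_of_secured_of_sampled hQ hQ' h hsecured hsampled
    refine Prod.Lex.toLex_lt_toLex.2 (htag.lt_or_eq.imp_right fun heq => ⟨heq, ?_⟩)
    refine Prod.Lex.toLex_lt_toLex.2 ((Bool.le_true _).lt_or_eq.imp_right fun hread => ⟨hread, ?_⟩)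
    exact Prod.Lex.toLex_lt_toLex.2 (.inl hstart)

theorem startClock_le_endClock_of_registerRank_le (hreg : (F.op y).reg = (F.op x).reg)
    (h : F.registerRank y ≤ F.registerRank x) : F.startClock y ≤ F.endClock x :=
  not_lt.1 fun hlt => (registerRank_lt_of_endClock_lt hreg.symm hlt).not_ge h

theorem readsLastWritten [LT O] (hlt : ∀ x y, (F.op x).reg = (F.op y).reg →
      (x < y ↔ F.registerRank x < F.registerRank y)) :
    F.ReadsLastWritten := by
  intro x r v hx hv
  have hval := eq_value_of_read hx hv
  have hreg : ∀ {y w}, F.op y = .write r w → (F.op y).reg = (F.op x).reg := fun hy => by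
    rw [hx, hy, Op.reg, Op.reg]
  have htag_le : ∀ {y w}, F.op y = .write r w → y < x → F.tag y ≤ F.tag x := fun hy hyx =>
    tag_le_of_registerRank_lt ((hlt _ _ (hreg hy)).1 hyx)
  obtain hinit | ⟨y, w, hy, htag⟩ := tag_eq_init_or_exists_write x
  · refine .inl ⟨by rw [hval, hinit]; rfl, fun y w hy hyx => ?_⟩
    exact (htag_le hy hyx).not_gt (hinit ▸ initTSV_lt_tag hy)
  · rw [hx, Op.reg] at hy
    obtain rfl : w = v := by rw [hval, ← htag, tag_eq_of_write hy]; rfl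
    refine .inr ⟨y, hy, (hlt _ _ (hreg hy)).2 (registerRank_lt_of_tag_eq hy hx htag), ?_⟩
    intro z w' hz hyz hzx
    have hrank := (hlt y z ((hreg hy).trans (hreg hz).symm)).1 hyz
    have hzy : F.tag z ≤ F.tag y := (htag_le hz hzx).trans_eq htag.symm
    rw [eq_of_tag_eq hz hy (hzy.antisymm (tag_le_of_registerRank_lt hrank))] at hrank
    exact lt_irrefl _ hrank

variable (F) in
/-- The key by which the orders of the operations on the individual registers are merged. -/
noncomputable def orderKey : O → ℕ ×ₗ (TSV ×ₗ (Bool ×ₗ (ℕ ×ₗ Fin n))) :=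
  mergeKey (fun x => (F.op x).reg) F.registerRank F.startClock

theorem bddAbove_startsBelow (x : O) :
    BddAbove (startsBelow (fun y => (F.op y).reg) F.registerRank F.startClock x) :=
  ⟨F.endClock x, Set.forall_mem_image.2 fun _ hy =>
    startClock_le_endClock_of_registerRank_le hy.1 hy.2⟩

theorem sc (F : E.TaggedOperations O) : E.history.SC := by
  let _ : LinearOrder O := LinearOrder.lift' F.orderKey (mergeKey_injective registerRank_injective)
  let _ : LocallyFiniteOrderBot O := LocallyFiniteOrderBot.ofIic O
    (fun x => (finite_setOf_mergeKey_le bddAbove_startsBelow finite_setOf_startClock_le x).toFinset)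
    fun _ _ => Set.Finite.mem_toFinset _
  refine F.toOperationFamily.sc (fun x y hproc hxy => ?_) (readsLastWritten fun x y hreg =>
    mergeKey_lt_mergeKey_iff bddAbove_startsBelow registerRank_injective hreg)
  exact mergeKey_lt_mergeKey_of_forall_le (bddAbove_startsBelow y)
    (fun z => startClock_le_endClock_of_registerRank_le) (endClock_lt_startClock hproc hxy)

end TaggedOperations

theorem sc_of_complete (hE : E.history.Complete) : E.history.SC :=
  (exists_taggedOperations hE).elim TaggedOperations.sc

end Execution

end Linearization

end SCABD

theorem mainTheorem1_general {X : Type*} {n : ℕ} (E : SCABD.Execution X n) :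
    (2 * E.faulty.ncard < n → E.EventualDelivery → E.Terminates) ∧
      (E.history.Complete → E.history.SC) :=
  ⟨SCABD.Execution.terminates, SCABD.Execution.sc_of_complete⟩

theorem mainTheorem1 {X : Type*} {n f : ℕ} (hf : 2 * f < n) (E : SCABD.Execution X n)
    (hE : E.faulty.ncard ≤ f) :
    (E.EventualDelivery → E.Terminates) ∧ (E.history.Complete → E.history.SC) :=
  (mainTheorem1_general E).imp_left fun h => h (by omega)
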